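/- Let $d\ge 1$, let $1\le p\le\infty$ and let $\|\cdot\|$ be the $l^p$-norm on $\mathbb{R}^d$. Let $X_1,X_2,\dots$ be i.i.d. random vectors in $\mathbb{R}^d$ with a common (essentially) bounded probability density function $f$, and let $(r_n)$ be a sequence of non-negative numbers with $r_n\to 0$. Let $G_n$ be the random geometric graph with vertices $X_1,\dots,X_n$ in which $X_i$ and $X_j$ ($i\ne j$) are adjacent if and only if $\|X_i-X_j\|<r_n$. For a graph $G$ and an integer $l\ge 1$, let $\chi(G)$ be the chromatic number of $G$, and let $\chi_l(G)$ be the distant-$l$ chromatic number, that is, the least number of colors in a vertex coloring of $G$ in which any two distinct vertices at graph distance at most $l$ have different colors. **Theorem 4 (Subconnectivity regime).** Suppose that $n^{-\varepsilon}=o(nr_n^d)$ for every $\varepsilon>0$ and that $nr_n^d=o(\ln n)$ as $n\to\infty$, and let $l\ge 1$ be a fixed integer. Then, almost surely, $$\frac{\chi_l(G_n)}{\chi(G_n)}\longrightarrow 1\qquad\text{as } n\to\infty .$$ -/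

import Mathlib

open MeasureTheory ProbabilityTheory Filter Asymptotics
open scoped ENNReal Topology

/-- A distant-`l` coloring of `G`: distinct vertices at graph distance at most `l` get different
colors. The extended distance `edist` is `⊤` between different components. -/
def IsDistantColoring {V C : Type*} (G : SimpleGraph V) (l : ℕ) (g : V → C) : Prop :=
  ∀ u v : V, u ≠ v → G.edist u v ≤ (l : ℕ∞) → g u ≠ g v

/-- The distant-`l` chromatic number: the least number `k` of colors for which a distant-`l`
coloring exists (`⊤` if there is none, which cannot happen on a finite vertex set). -/
noncomputable def distantChromaticNumber {V : Type*} (G : SimpleGraph V) (l : ℕ) : ℕ∞ :=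
  ⨅ k ∈ {k : ℕ | ∃ g : V → Fin k, IsDistantColoring G l g}, (k : ℕ∞)

/-- The geometric graph on points `x i` of `ℝ^d`: `i ≠ j` are adjacent iff the `l^p`-distance of
`x i` and `x j` is less than `r`. -/
def geometricGraph {d : ℕ} {ι : Type*} (p : ℝ≥0∞) (x : ι → Fin d → ℝ) (r : ℝ) :
    SimpleGraph ι where
  Adj i j := i ≠ j ∧ ‖WithLp.toLp p (x i - x j)‖ < r
  symm := by
    constructor
    rintro i j ⟨hij, h⟩
    refine ⟨hij.symm, ?_⟩
    have key : ‖WithLp.toLp p (x j - x i)‖ = ‖WithLp.toLp p (x i - x j)‖ := by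
      rcases p.trichotomy with rfl | rfl | hp
      · simp only [PiLp.norm_eq_card, Pi.sub_apply, norm_sub_rev]
      · simp only [PiLp.norm_eq_ciSup, Pi.sub_apply, norm_sub_rev]
      · simp only [PiLp.norm_eq_sum hp, Pi.sub_apply, norm_sub_rev]
    rwa [key]
  loopless := ⟨fun i h => h.1 rfl⟩

/-- The random geometric graph on the first `n` points of the sequence `X`, at the outcome `ω`. -/
def randomGeometricGraph {Ω : Type*} {d : ℕ} (p : ℝ≥0∞) (X : ℕ → Ω → Fin d → ℝ) (r : ℕ → ℝ)
    (n : ℕ) (ω : Ω) : SimpleGraph (Fin n) :=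
  geometricGraph p (fun i : Fin n => X i ω) (r n)

/-!
Write `a n = n * r n ^ d` and `k n = log n / log (log n / a n)`. In this regime `k` solves
`k * log (k / (C * a n)) = log n` to first order whatever the constant `C > 0` is. Consequently
the largest number of points in a set whose diameter is a constant multiple of `r n` is
`(1 + o(1)) * k n`, with no dependence on the constant. Points in a sufficiently small cube form a
clique, and greedy coloring bounds the distant chromatic number by the largest number of points in
a ball of radius `l * r n` around a vertex, so both chromatic numbers are asymptotic to `k n`.

Almost surely, some cube does contain that many points because the occupation numbers of disjoint
cubes are negatively correlated, so that the probability that all of them are small is at most the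
product of the individual probabilities. No ball contains more by a first moment bound; as this
bound is not summable in `n`, it is applied along `n = 2 ^ j` only, to an event that is monotone in
the sample size and covers all admissible radii at once.
-/

open Classical in
/-- The number of indices `i ∈ I` with `x i ∈ A`. It is the only way in which the points enter the
bounds on both chromatic numbers. -/
noncomputable def pointCount {ι E : Type*} (x : ι → E) (I : Finset ι) (A : Set E) : ℕ :=
  (I.filter fun i => x i ∈ A).card

section Coloring

variable {V : Type*} {G H : SimpleGraph V} {l k : ℕ}

theorem colorable_of_forall_degree_lt [Fintype V] [DecidableRel G.Adj]
    (hG : ∀ v, G.degree v < k) : G.Colorable k := by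
  classical
  suffices h : ∀ s : Finset V, ∃ g : V → Fin k, ∀ u ∈ s, ∀ v ∈ s, G.Adj u v → g u ≠ g v by
    obtain ⟨g, hg⟩ := h Finset.univ
    exact ⟨.mk g fun {u v} => hg u (Finset.mem_univ u) v (Finset.mem_univ v)⟩
  intro s
  induction s using Finset.induction_on with
  | empty => exact ⟨fun v => ⟨0, (Nat.zero_le _).trans_lt (hG v)⟩, by simp⟩
  | insert a s ha ih =>
    obtain ⟨g, hg⟩ := ih
    obtain ⟨c, -, hc⟩ : ∃ c ∈ Finset.univ, c ∉ (G.neighborFinset a).image g :=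
      Finset.exists_mem_notMem_of_card_lt_card <| Finset.card_image_le.trans_lt <| by
        simpa using hG a
    have hc' : ∀ u, G.Adj a u → g u ≠ c := fun u hu huc =>
      hc (Finset.mem_image.2 ⟨u, (G.mem_neighborFinset a u).2 hu, huc⟩)
    have hne : ∀ u ∈ s, u ≠ a := fun u hu => ne_of_mem_of_not_mem hu ha
    refine ⟨Function.update g a c, fun u hu v hv huv => ?_⟩
    rcases Finset.mem_insert.1 hu with rfl | hus <;>
      rcases Finset.mem_insert.1 hv with rfl | hvs
    · exact absurd rfl huv.ne
    · simpa [hne v hvs] using (hc' v huv).symm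
    · simpa [hne u hus] using hc' u huv.symm
    · simpa [hne u hus, hne v hvs] using hg u hus v hvs huv

theorem chromaticNumber_le_distantChromaticNumber (hl : 1 ≤ l) :
    G.chromaticNumber ≤ distantChromaticNumber G l := by
  refine le_iInf₂ fun k ⟨g, hg⟩ => SimpleGraph.chromaticNumber_le_iff_colorable.2 ⟨.mk g ?_⟩
  intro u v huv
  refine hg u v huv.ne ?_
  rw [SimpleGraph.edist_eq_one_iff_adj.2 huv]
  exact_mod_cast hl

theorem distantChromaticNumber_le_of_colorable (hH : H.Colorable k)
    (hGH : ∀ u v, u ≠ v → G.edist u v ≤ l → H.Adj u v) : distantChromaticNumber G l ≤ k :=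
  hH.elim fun g => iInf₂_le k ⟨g, fun u v huv h => g.valid (hGH u v huv h)⟩

end Coloring

section GeometricGraph

variable {d : ℕ} {ι : Type*} {p : ℝ≥0∞} {x : ι → Fin d → ℝ} {r : ℝ}

theorem norm_le_norm_toLp (hp : 1 ≤ p) (v : Fin d → ℝ) : ‖v‖ ≤ ‖WithLp.toLp p v‖ := by
  have : Fact (1 ≤ p) := ⟨hp⟩
  exact (pi_norm_le_iff_of_nonneg (norm_nonneg _)).2 (PiLp.norm_apply_le (WithLp.toLp p v))

theorem norm_toLp_le_mul_norm (hp : 1 ≤ p) (v : Fin d → ℝ) :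
    ‖WithLp.toLp p v‖ ≤ d * ‖v‖ := by
  have : Fact (1 ≤ p) := ⟨hp⟩
  calc ‖WithLp.toLp p v‖ = ‖∑ i, WithLp.toLp p (Pi.single i (v i))‖ := by
        rw [← WithLp.toLp_sum, Finset.univ_sum_single]
    _ ≤ ∑ i, ‖WithLp.toLp p (Pi.single i (v i) : Fin d → ℝ)‖ := norm_sum_le _ _
    _ ≤ ∑ _i : Fin d, ‖v‖ := Finset.sum_le_sum fun i _ =>
        (PiLp.norm_single p (fun _ => ℝ) i (v i)).trans_le (norm_le_pi_norm v i)
    _ = d * ‖v‖ := by simp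

theorem norm_sub_le_length_mul (hp : 1 ≤ p) {u v : ι} (w : (geometricGraph p x r).Walk u v) :
    ‖x u - x v‖ ≤ w.length * r := by
  induction w with
  | nil => simp
  | @cons u v t huv w ih =>
    calc ‖x u - x t‖ ≤ ‖x u - x v‖ + ‖x v - x t‖ := norm_sub_le_norm_sub_add_norm_sub _ _ _
      _ ≤ r + w.length * r := add_le_add ((norm_le_norm_toLp hp _).trans huv.2.le) ih
      _ = (SimpleGraph.Walk.cons huv w).length * r := by
        rw [SimpleGraph.Walk.length_cons]; push_cast; ring

theorem norm_sub_le_of_edist_le (hp : 1 ≤ p) (hr : 0 ≤ r) {l : ℕ} {u v : ι}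
    (h : (geometricGraph p x r).edist u v ≤ l) : ‖x u - x v‖ ≤ l * r := by
  obtain ⟨w, hw⟩ := SimpleGraph.exists_walk_of_edist_ne_top
    (ne_top_of_le_ne_top (ENat.natCast_ne_top l) h)
  have hwl : w.length ≤ l := by
    rw [← hw] at h
    exact_mod_cast h
  calc ‖x u - x v‖ ≤ w.length * r := norm_sub_le_length_mul hp w
    _ ≤ l * r := by gcongr

theorem distantChromaticNumber_geometricGraph_le [Fintype ι] (hp : 1 ≤ p) (hr : 0 ≤ r) {l D : ℕ}
    (hD : ∀ v, pointCount x Finset.univ (Metric.closedBall (x v) (l * r)) ≤ D) :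
    distantChromaticNumber (geometricGraph p x r) l ≤ D := by
  classical
  let H : SimpleGraph ι := SimpleGraph.fromRel fun u v => dist (x u) (x v) ≤ l * r
  have hadj : ∀ u v, H.Adj u v ↔ u ≠ v ∧ dist (x u) (x v) ≤ l * r := fun u v => by
    simp [H, SimpleGraph.fromRel_adj, dist_comm]
  refine distantChromaticNumber_le_of_colorable (H := H)
    (colorable_of_forall_degree_lt fun v => (Finset.card_lt_card ?_).trans_le (hD v))
    fun u v huv h => (hadj u v).2 ⟨huv, (dist_eq_norm _ _).trans_le ?_⟩
  · refine Finset.ssubset_iff_subset_ne.2 ⟨fun u hu => ?_, fun h => ?_⟩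
    · have := (hadj v u).1 ((H.mem_neighborFinset v u).1 hu)
      simpa [dist_comm] using this.2
    · have hv : v ∈ H.neighborFinset v := by
        rw [h]
        simpa using mul_nonneg l.cast_nonneg hr
      simp at hv
  · exact norm_sub_le_of_edist_le hp hr h

/-- The half-open cube `∏ i, [s * z i, s * (z i + 1))` of the grid of mesh `s > 0`. -/
def gridCube (s : ℝ) (z : Fin d → ℤ) : Set (Fin d → ℝ) :=
  {x | ∀ i, ⌊x i / s⌋ = z i}

theorem dist_le_of_mem_gridCube {s : ℝ} (hs : 0 < s) {z : Fin d → ℤ} {y y' : Fin d → ℝ}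
    (hy : y ∈ gridCube s z) (hy' : y' ∈ gridCube s z) : dist y y' ≤ s := by
  refine (dist_pi_le_iff hs.le).2 fun i => ?_
  have h := Int.abs_sub_lt_one_of_floor_eq_floor ((hy i).trans (hy' i).symm)
  rw [← sub_div, abs_div, abs_of_pos hs, div_lt_one hs] at h
  exact h.le

theorem pointCount_gridCube_le_chromaticNumber [Fintype ι] (hp : 1 ≤ p) (hr : 0 < r)
    (z : Fin d → ℤ) :
    pointCount x Finset.univ (gridCube (r / (d + 1)) z) ≤
      (geometricGraph p x r).chromaticNumber := by
  refine SimpleGraph.IsClique.card_le_chromaticNumber fun i hi j hj hij => ⟨hij, ?_⟩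
  have hdist : ‖x i - x j‖ ≤ r / (d + 1) := by
    rw [← dist_eq_norm]
    exact dist_le_of_mem_gridCube (by positivity) (by simpa using hi) (by simpa using hj)
  calc ‖WithLp.toLp p (x i - x j)‖ ≤ d * ‖x i - x j‖ := norm_toLp_le_mul_norm hp _
    _ ≤ d * (r / (d + 1)) := by gcongr
    _ = r * (d / (d + 1)) := by ring
    _ < r := mul_lt_of_lt_one_right hr ((div_lt_one (by positivity)).2 (by linarith))

end GeometricGraph

section PointCount

variable {ι E : Type*} {I J : Finset ι} {A B : Set E}

theorem pointCount_mono (x : ι → E) (hIJ : I ⊆ J) (hAB : A ⊆ B) :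
    pointCount x I A ≤ pointCount x J B := by
  classical
  exact Finset.card_le_card fun _ hi =>
    Finset.mem_filter.2 ((Finset.mem_filter.1 hi).imp (@hIJ _) (@hAB _))

theorem pointCount_insert [DecidableEq ι] (x : ι → E) {i : ι} (hi : i ∉ I) :
    pointCount x (insert i I) A = A.indicator 1 (x i) + pointCount x I A := by
  by_cases h : x i ∈ A <;> simp [pointCount, Finset.filter_insert, h, hi, add_comm]

theorem pointCount_map {κ : Type*} (x : ι → E) (K : Finset κ) (e : κ ↪ ι) :
    pointCount x (K.map e) A = pointCount (x ∘ e) K A := by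
  simp [pointCount, Finset.filter_map, Function.comp_def]

theorem pointCount_univ_restrict (x : ι → E) :
    pointCount (I.restrict x) Finset.univ A = pointCount x I A := by
  conv_rhs => rw [← Finset.attach_map_val (s := I), pointCount_map]
  rfl

theorem pointCount_univ_fin (x : ℕ → E) (n : ℕ) :
    pointCount (fun i : Fin n => x i) Finset.univ A = pointCount x (Finset.range n) A := by
  rw [← Nat.Iio_eq_range, ← Fin.map_valEmbedding_univ, pointCount_map]
  rfl

theorem le_pointCount_iff {x : ι → E} {m : ℕ} :
    m ≤ pointCount x I A ↔ ∃ S ∈ I.powersetCard m, ∀ i ∈ S, x i ∈ A := by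
  classical
  constructor
  · intro h
    obtain ⟨S, hS, hSm⟩ := Finset.exists_subset_card_eq h
    exact ⟨S, Finset.mem_powersetCard.2 ⟨hS.trans (Finset.filter_subset _ _), hSm⟩,
      fun i hi => (Finset.mem_filter.1 (hS hi)).2⟩
  · rintro ⟨S, hS, hSA⟩
    obtain ⟨hSI, rfl⟩ := Finset.mem_powersetCard.1 hS
    exact Finset.card_le_card fun i hi => Finset.mem_filter.2 ⟨hSI hi, hSA i hi⟩

theorem measurable_pointCount {β : Type*} [MeasurableSpace β] {x : β → ι → E} {A : β → Set E}
    (hA : ∀ i ∈ I, MeasurableSet {b | x b i ∈ A b}) :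
    Measurable fun b => pointCount (x b) I (A b) := by
  classical
  have h : (fun b => pointCount (x b) I (A b)) =
      fun b => ∑ i ∈ I, {b | x b i ∈ A b}.indicator 1 b := by
    ext b
    simp only [pointCount, Finset.card_filter, Set.indicator_apply, Set.mem_ofPred_eq, Pi.one_apply]
  rw [h]
  exact Finset.measurable_fun_sum I fun i hi => measurable_const.indicator (hA i hi)

end PointCount

section NegativeAssociation

theorem prod_sub_sum_prod_erase_le {κ : Type*} [DecidableEq κ] (T : Finset κ) {q y : κ → ℝ}
    (hy : ∀ j ∈ T, 0 ≤ y j) (hyq : ∀ j ∈ T, y j ≤ q j) :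
    ∏ j ∈ T, q j - ∑ j ∈ T, y j * ∏ k ∈ T.erase j, q k ≤ ∏ j ∈ T, (q j - y j) := by
  induction T using Finset.induction_on with
  | empty => simp
  | insert a T ha ih =>
    rw [Finset.forall_mem_insert] at hy hyq
    have herase : ∀ j ∈ T, y j * ∏ k ∈ (insert a T).erase j, q k =
        q a * (y j * ∏ k ∈ T.erase j, q k) := fun j hj => by
      have haj : a ≠ j := (ne_of_mem_of_not_mem hj ha).symm
      rw [Finset.erase_insert_of_ne haj,
        Finset.prod_insert fun h => ha (Finset.mem_of_mem_erase h), mul_left_comm]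
    have hsum : 0 ≤ ∑ j ∈ T, y j * ∏ k ∈ T.erase j, q k := Finset.sum_nonneg fun j hj =>
      mul_nonneg (hy.2 j hj) <| Finset.prod_nonneg fun k hk =>
        have hk := Finset.mem_of_mem_erase hk
        (hy.2 k hk).trans (hyq.2 k hk)
    rw [Finset.prod_insert ha, Finset.prod_insert ha, Finset.sum_insert ha,
      Finset.erase_insert ha, Finset.sum_congr rfl herase, ← Finset.mul_sum]
    calc _ ≤ (q a - y a) * (∏ j ∈ T, q j - ∑ j ∈ T, y j * ∏ k ∈ T.erase j, q k) := by
          linarith [mul_nonneg hy.1 hsum]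
      _ ≤ _ := mul_le_mul_of_nonneg_left (ih hy.2 hyq.2) (sub_nonneg.2 hyq.1)

theorem one_sub_sum_mul_prod_add_sum_le_prod {κ : Type*} [DecidableEq κ] (T : Finset κ)
    {p q q' : κ → ℝ} (hp₀ : ∀ j ∈ T, 0 ≤ p j) (hp₁ : ∀ j ∈ T, p j ≤ 1) (hq' : ∀ j ∈ T, 0 ≤ q' j)
    (hq'q : ∀ j ∈ T, q' j ≤ q j) :
    (1 - ∑ j ∈ T, p j) * ∏ j ∈ T, q j + ∑ j ∈ T, p j * (q' j * ∏ k ∈ T.erase j, q k) ≤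
      ∏ j ∈ T, ((1 - p j) * q j + p j * q' j) := by
  calc _ = ∏ j ∈ T, q j - ∑ j ∈ T, p j * (q j - q' j) * ∏ k ∈ T.erase j, q k := by
        rw [sub_mul, one_mul, Finset.sum_mul, sub_add, ← Finset.sum_sub_distrib]
        congr 1
        refine Finset.sum_congr rfl fun j hj => ?_
        rw [← Finset.mul_prod_erase T q hj]
        ring
    _ ≤ ∏ j ∈ T, (q j - p j * (q j - q' j)) := by
        refine prod_sub_sum_prod_erase_le T
          (fun j hj => mul_nonneg (hp₀ j hj) (sub_nonneg.2 (hq'q j hj))) fun j hj => ?_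
        exact (mul_le_of_le_one_left (sub_nonneg.2 (hq'q j hj)) (hp₁ j hj)).trans
          (sub_le_self _ (hq' j hj))
    _ = _ := Finset.prod_congr rfl fun j _ => by ring

variable {ι κ E : Type*} {A : κ → Set E} {T : Finset κ}

theorem forall_pointCount_insert_lt_iff_of_forall_notMem [DecidableEq ι] {x : ι → E} {i : ι}
    {I : Finset ι} (hi : i ∉ I) (hx : ∀ j ∈ T, x i ∉ A j) {m : κ → ℕ} :
    (∀ j ∈ T, pointCount x (insert i I) (A j) < m j) ↔ ∀ j ∈ T, pointCount x I (A j) < m j :=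
  forall₂_congr fun j hj => by
    rw [pointCount_insert x hi, Set.indicator_of_notMem (hx j hj), zero_add]

theorem forall_pointCount_insert_lt_iff_of_mem [DecidableEq ι] [DecidableEq κ] {x : ι → E}
    (hdisj : (T : Set κ).PairwiseDisjoint A) {i : ι} {I : Finset ι} (hi : i ∉ I) {j : κ}
    (hj : j ∈ T) (hx : x i ∈ A j) {m : κ → ℕ} :
    (∀ k ∈ T, pointCount x (insert i I) (A k) < m k) ↔
      ∀ k ∈ T, pointCount x I (A k) < Function.update m j (m j - 1) k := by
  refine forall₂_congr fun k hk => ?_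
  rw [pointCount_insert x hi]
  rcases eq_or_ne k j with rfl | hkj
  · rw [Set.indicator_of_mem hx, Function.update_self, Pi.one_apply]
    omega
  · have hxk : x i ∉ A k := fun h => Set.disjoint_left.1 (hdisj hk hj hkj) h hx
    rw [Set.indicator_of_notMem hxk, Function.update_of_ne hkj, zero_add]

variable {Ω : Type*} [MeasurableSpace Ω] [MeasurableSpace E] {μ : Measure Ω} {X : ι → Ω → E}

theorem indepFun_restrict_of_notMem (hind : iIndepFun X μ) (hX : ∀ i, Measurable (X i)) {i : ι}
    {I : Finset ι} (hi : i ∉ I) : IndepFun (X i) (fun ω => I.restrict (X · ω)) μ :=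
  (hind.indepFun_finset {i} I (Finset.disjoint_singleton_left.2 hi) hX).comp
    (measurable_pi_apply (⟨i, Finset.mem_singleton_self i⟩ : ({i} : Finset ι))) measurable_id

theorem measurableSet_forall_pointCount_lt (hA : ∀ j ∈ T, MeasurableSet (A j)) {x : Ω → ι → E}
    {I : Finset ι} (hx : ∀ i ∈ I, Measurable (x · i)) (m : κ → ℕ) :
    MeasurableSet {ω | ∀ j ∈ T, pointCount (x ω) I (A j) < m j} := by
  have h : {ω | ∀ j ∈ T, pointCount (x ω) I (A j) < m j} =
      ⋂ j ∈ T, {ω | pointCount (x ω) I (A j) < m j} := by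
    ext
    simp
  rw [h]
  exact T.measurableSet_biInter fun j hj =>
    (measurable_pointCount fun i hi => hx i hi (hA j hj)) measurableSet_Iio

theorem measureReal_preimage_inter_forall_pointCount_lt (hind : iIndepFun X μ)
    (hX : ∀ i, Measurable (X i)) {i : ι} {I : Finset ι} (hi : i ∉ I) {B : Set E}
    (hB : MeasurableSet B) (hA : ∀ j ∈ T, MeasurableSet (A j)) (m : κ → ℕ) :
    μ.real (X i ⁻¹' B ∩ {ω | ∀ j ∈ T, pointCount (X · ω) I (A j) < m j}) =
      μ.real (X i ⁻¹' B) * μ.real {ω | ∀ j ∈ T, pointCount (X · ω) I (A j) < m j} := by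
  have hQ := measurableSet_forall_pointCount_lt hA (x := fun y : I → E => y)
    (I := Finset.univ) (fun k _ => measurable_pi_apply k) m
  have h := (indepFun_restrict_of_notMem hind hX hi).measure_inter_preimage_eq_mul _ _ hB hQ
  simpa only [Set.preimage_ofPred_eq, pointCount_univ_restrict, Measure.real, ENNReal.toReal_mul]
    using congrArg ENNReal.toReal h

theorem measureReal_preimage_biUnion_finset [IsFiniteMeasure μ] {Y : Ω → E} (hY : Measurable Y)
    (hA : ∀ j ∈ T, MeasurableSet (A j)) (hdisj : (T : Set κ).PairwiseDisjoint A) :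
    μ.real (Y ⁻¹' ⋃ j ∈ T, A j) = ∑ j ∈ T, μ.real (Y ⁻¹' A j) := by
  rw [Set.preimage_iUnion₂]
  exact measureReal_biUnion_finset (fun j hj k hk hjk => (hdisj hj hk hjk).preimage Y)
    fun j hj => hY (hA j hj)

/-- Total probability over the cell that contains the new point `X i`. -/
theorem measureReal_forall_pointCount_insert_lt [DecidableEq ι] [DecidableEq κ]
    (hind : iIndepFun X μ) (hX : ∀ i, Measurable (X i)) (hA : ∀ j ∈ T, MeasurableSet (A j))
    (hdisj : (T : Set κ).PairwiseDisjoint A) {i : ι} {I : Finset ι} (hi : i ∉ I) (m : κ → ℕ) :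
    μ.real {ω | ∀ j ∈ T, pointCount (X · ω) (insert i I) (A j) < m j} =
      (1 - ∑ j ∈ T, μ.real (X i ⁻¹' A j)) *
          μ.real {ω | ∀ j ∈ T, pointCount (X · ω) I (A j) < m j} +
        ∑ j ∈ T, μ.real (X i ⁻¹' A j) *
          μ.real {ω | ∀ k ∈ T, pointCount (X · ω) I (A k) < Function.update m j (m j - 1) k} := by
  have := hind.isProbabilityMeasure
  set Q := {ω | ∀ j ∈ T, pointCount (X · ω) (insert i I) (A j) < m j}
  set B := ⋃ j ∈ T, A j with hB_def
  have hB : MeasurableSet B := T.measurableSet_biUnion hA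
  have hoff : Q \ X i ⁻¹' B =
      X i ⁻¹' Bᶜ ∩ {ω | ∀ j ∈ T, pointCount (X · ω) I (A j) < m j} := by
    ext ω
    rw [Set.mem_sdiff, and_comm]
    exact and_congr_right fun hω =>
      forall_pointCount_insert_lt_iff_of_forall_notMem hi fun j hj h =>
        hω (Set.mem_biUnion hj h)
  have hon : ∀ j ∈ T, Q ∩ X i ⁻¹' A j = X i ⁻¹' A j ∩
      {ω | ∀ k ∈ T, pointCount (X · ω) I (A k) < Function.update m j (m j - 1) k} := by
    intro j hj
    ext ω
    rw [Set.mem_inter_iff, and_comm]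
    exact and_congr_right fun hω => forall_pointCount_insert_lt_iff_of_mem hdisj hi hj hω
  have hinter : μ.real (Q ∩ X i ⁻¹' B) = ∑ j ∈ T, μ.real (Q ∩ X i ⁻¹' A j) := by
    rw [hB_def, Set.preimage_iUnion₂, Set.inter_iUnion₂]
    refine measureReal_biUnion_finset (fun j hj k hk hjk => ((hdisj hj hk hjk).preimage (X i)).mono
      Set.inter_subset_right Set.inter_subset_right) fun j hj => ?_
    exact (measurableSet_forall_pointCount_lt hA (fun k _ => hX k) m).inter (hX i (hA j hj))
  have hcompl : μ.real (X i ⁻¹' Bᶜ) = 1 - ∑ j ∈ T, μ.real (X i ⁻¹' A j) := by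
    rw [Set.preimage_compl, probReal_compl_eq_one_sub (hX i hB),
      measureReal_preimage_biUnion_finset (hX i) hA hdisj]
  rw [← measureReal_inter_add_sdiff (hX i hB), hinter, hoff,
    measureReal_preimage_inter_forall_pointCount_lt hind hX hi hB.compl hA, hcompl, add_comm]
  congr 1
  refine Finset.sum_congr rfl fun j hj => ?_
  rw [hon j hj, measureReal_preimage_inter_forall_pointCount_lt hind hX hi (hA j hj) hA]

theorem measureReal_pointCount_insert_lt [DecidableEq ι]
    (hind : iIndepFun X μ) (hX : ∀ i, Measurable (X i)) {A : Set E} (hA : MeasurableSet A) {i : ι}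
    {I : Finset ι} (hi : i ∉ I) (m : ℕ) :
    μ.real {ω | pointCount (X · ω) (insert i I) A < m} =
      (1 - μ.real (X i ⁻¹' A)) * μ.real {ω | pointCount (X · ω) I A < m} +
        μ.real (X i ⁻¹' A) * μ.real {ω | pointCount (X · ω) I A < m - 1} := by
  simpa using measureReal_forall_pointCount_insert_lt (T := {()}) (A := fun _ => A) hind hX
    (by simpa using hA) (by simp) hi fun _ => m

/-- Mallows' inequality. Conditioning on one point at a time reduces it to the inequality
`one_sub_sum_mul_prod_add_sum_le_prod`. -/
theorem measureReal_forall_pointCount_lt_le_prod (hind : iIndepFun X μ)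
    (hX : ∀ i, Measurable (X i)) (hA : ∀ j ∈ T, MeasurableSet (A j))
    (hdisj : (T : Set κ).PairwiseDisjoint A) (I : Finset ι) (m : κ → ℕ) :
    μ.real {ω | ∀ j ∈ T, pointCount (X · ω) I (A j) < m j} ≤
      ∏ j ∈ T, μ.real {ω | pointCount (X · ω) I (A j) < m j} := by
  have := hind.isProbabilityMeasure
  classical
  induction I using Finset.induction_on generalizing m with
  | empty =>
    by_cases hm : ∀ j ∈ T, 0 < m j
    · refine measureReal_le_one.trans_eq (Finset.prod_eq_one fun j hj => ?_).symm
      simp [pointCount, hm j hj]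
    · have : {ω : Ω | ∀ j ∈ T, pointCount (X · ω) ∅ (A j) < m j} = ∅ :=
        Set.eq_empty_of_forall_notMem fun ω hω => hm (by simpa [pointCount] using hω)
      rw [this, measureReal_empty]
      exact Finset.prod_nonneg fun _ _ => measureReal_nonneg
  | insert i I hi ih =>
    set q : κ → ℝ := fun j => μ.real {ω | pointCount (X · ω) I (A j) < m j}
    set q' : κ → ℝ := fun j => μ.real {ω | pointCount (X · ω) I (A j) < m j - 1}
    have hsum : ∑ j ∈ T, μ.real (X i ⁻¹' A j) ≤ 1 :=
      (measureReal_preimage_biUnion_finset (hX i) hA hdisj).symm.trans_le measureReal_le_one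
    have hq'q : ∀ j ∈ T, q' j ≤ q j := fun j _ =>
      measureReal_mono fun ω (hω : _ < _) => hω.trans_le (m j).pred_le
    have hupdate : ∀ j ∈ T,
        μ.real {ω | ∀ k ∈ T, pointCount (X · ω) I (A k) < Function.update m j (m j - 1) k} ≤
          q' j * ∏ k ∈ T.erase j, q k := fun j hj => by
      refine (ih _).trans_eq ?_
      rw [← Finset.mul_prod_erase T _ hj, Function.update_self]
      congr 1
      exact Finset.prod_congr rfl fun k hk => by
        rw [Function.update_of_ne (Finset.ne_of_mem_erase hk)]
    rw [measureReal_forall_pointCount_insert_lt hind hX hA hdisj hi,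
      Finset.prod_congr rfl fun j hj => measureReal_pointCount_insert_lt hind hX (hA j hj) hi (m j)]
    refine le_trans ?_ (one_sub_sum_mul_prod_add_sum_le_prod T (fun _ _ => measureReal_nonneg)
      (fun _ _ => measureReal_le_one) (fun _ _ => measureReal_nonneg) hq'q)
    gcongr with j hj
    · exact ih m
    · exact hupdate j hj

end NegativeAssociation

section BinomialBounds

variable {Ω ι E : Type*} {X : ι → Ω → E} {A : Set E} {I : Finset ι}

theorem setOf_forall_mem_iff_eq_iInter [DecidableEq ι] (S : Finset ι) :
    {ω | ∀ i ∈ I, X i ω ∈ A ↔ i ∈ S} = ⋂ i ∈ I, X i ⁻¹' if i ∈ S then A else Aᶜ := by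
  ext ω
  refine (forall₂_congr fun i _ => ?_).trans Set.mem_iInter₂.symm
  by_cases h : i ∈ S <;> simp [h]

theorem pairwiseDisjoint_setOf_forall_mem_iff (m : ℕ) :
    (I.powersetCard m : Set (Finset ι)).PairwiseDisjoint
      fun S => {ω | ∀ i ∈ I, X i ω ∈ A ↔ i ∈ S} := by
  refine fun S hS S' hS' hne => Set.disjoint_left.2 fun ω hω hω' => hne ?_
  have hSI : S ⊆ I := (Finset.mem_powersetCard.1 hS).1
  have hSI' : S' ⊆ I := (Finset.mem_powersetCard.1 hS').1
  ext i
  by_cases hi : i ∈ I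
  · exact (hω i hi).symm.trans (hω' i hi)
  · exact iff_of_false (fun h => hi (hSI h)) fun h => hi (hSI' h)

variable [MeasurableSpace Ω] [MeasurableSpace E] {μ : Measure Ω}

theorem measureReal_iInter_preimage (hind : iIndepFun X μ) {B : ι → Set E}
    (hB : ∀ i ∈ I, MeasurableSet (B i)) :
    μ.real (⋂ i ∈ I, X i ⁻¹' B i) = ∏ i ∈ I, μ.real (X i ⁻¹' B i) := by
  simp only [Measure.real, hind.measure_inter_preimage_eq_mul I hB, ENNReal.toReal_prod]

theorem measureReal_le_pointCount_le (hind : iIndepFun X μ) (hA : MeasurableSet A) {b : ℝ}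
    (hb : ∀ i ∈ I, μ.real (X i ⁻¹' A) ≤ b) (m : ℕ) :
    μ.real {ω | m ≤ pointCount (X · ω) I A} ≤ I.card.choose m * b ^ m := by
  have := hind.isProbabilityMeasure
  have hcover : {ω | m ≤ pointCount (X · ω) I A} = ⋃ S ∈ I.powersetCard m, ⋂ i ∈ S, X i ⁻¹' A := by
    ext ω
    simp only [Set.mem_ofPred_eq, le_pointCount_iff, Set.mem_iUnion, Set.mem_iInter,
      Set.mem_preimage, exists_prop]
  calc μ.real {ω | m ≤ pointCount (X · ω) I A}
      ≤ ∑ S ∈ I.powersetCard m, μ.real (⋂ i ∈ S, X i ⁻¹' A) := by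
        rw [hcover]
        exact measureReal_biUnion_finset_le _ _
    _ ≤ ∑ _S ∈ I.powersetCard m, b ^ m := by
        refine Finset.sum_le_sum fun S hS => ?_
        obtain ⟨hSI, rfl⟩ := Finset.mem_powersetCard.1 hS
        rw [measureReal_iInter_preimage hind fun _ _ => hA, ← Finset.prod_const]
        exact Finset.prod_le_prod (fun _ _ => measureReal_nonneg) fun i hi => hb i (hSI hi)
    _ = I.card.choose m * b ^ m := by simp

theorem measurableSet_ite_compl [DecidableEq ι] (hA : MeasurableSet A) (S : Finset ι) (i : ι) :
    MeasurableSet (if i ∈ S then A else Aᶜ) := by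
  split_ifs
  exacts [hA, hA.compl]

theorem le_measureReal_forall_mem_iff (hind : iIndepFun X μ) (hX : ∀ i, Measurable (X i))
    (hA : MeasurableSet A) {q t : ℝ} (hq : 0 ≤ q) (ht : t ≤ 1)
    (hqt : ∀ i ∈ I, μ.real (X i ⁻¹' A) ∈ Set.Icc q t) {S : Finset ι} (hS : S ⊆ I) :
    q ^ S.card * (1 - t) ^ (I.card - S.card) ≤ μ.real {ω | ∀ i ∈ I, X i ω ∈ A ↔ i ∈ S} := by
  classical
  have := hind.isProbabilityMeasure
  rw [setOf_forall_mem_iff_eq_iInter,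
    measureReal_iInter_preimage hind fun i _ => measurableSet_ite_compl hA S i,
    ← Finset.card_sdiff_of_subset hS, ← Finset.prod_sdiff hS, mul_comm, ← Finset.prod_const,
    ← Finset.prod_const]
  refine mul_le_mul ?_ ?_ (Finset.prod_nonneg fun _ _ => hq)
    (Finset.prod_nonneg fun _ _ => measureReal_nonneg)
  · refine Finset.prod_le_prod (fun _ _ => sub_nonneg.2 ht) fun i hi => ?_
    obtain ⟨hiI, hiS⟩ := Finset.mem_sdiff.1 hi
    rw [if_neg hiS, Set.preimage_compl, probReal_compl_eq_one_sub (hX i hA)]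
    exact sub_le_sub_left (hqt i hiI).2 1
  · exact Finset.prod_le_prod (fun _ _ => hq) fun i hi => by
      rw [if_pos hi]
      exact (hqt i (hS hi)).1

theorem le_measureReal_le_pointCount (hind : iIndepFun X μ) (hX : ∀ i, Measurable (X i))
    (hA : MeasurableSet A) {q t : ℝ} (hq : 0 ≤ q) (ht : t ≤ 1)
    (hqt : ∀ i ∈ I, μ.real (X i ⁻¹' A) ∈ Set.Icc q t) (m : ℕ) :
    I.card.choose m * (q ^ m * (1 - t) ^ (I.card - m)) ≤
      μ.real {ω | m ≤ pointCount (X · ω) I A} := by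
  classical
  have := hind.isProbabilityMeasure
  calc I.card.choose m * (q ^ m * (1 - t) ^ (I.card - m))
      = ∑ _S ∈ I.powersetCard m, q ^ m * (1 - t) ^ (I.card - m) := by simp
    _ ≤ ∑ S ∈ I.powersetCard m, μ.real {ω | ∀ i ∈ I, X i ω ∈ A ↔ i ∈ S} := by
        refine Finset.sum_le_sum fun S hS => ?_
        obtain ⟨hSI, rfl⟩ := Finset.mem_powersetCard.1 hS
        exact le_measureReal_forall_mem_iff hind hX hA hq ht hqt hSI
    _ = μ.real (⋃ S ∈ I.powersetCard m, {ω | ∀ i ∈ I, X i ω ∈ A ↔ i ∈ S}) := by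
        refine (measureReal_biUnion_finset (pairwiseDisjoint_setOf_forall_mem_iff m)
          fun S _ => ?_).symm
        rw [setOf_forall_mem_iff_eq_iInter]
        exact I.measurableSet_biInter fun i _ => hX i (measurableSet_ite_compl hA S i)
    _ ≤ μ.real {ω | m ≤ pointCount (X · ω) I A} := by
        refine measureReal_mono fun ω hω => ?_
        obtain ⟨S, hS, hωS⟩ := Set.mem_iUnion₂.1 hω
        have hSI := (Finset.mem_powersetCard.1 hS).1
        exact le_pointCount_iff.2 ⟨S, hS, fun i hi => (hωS i (hSI hi)).2 hi⟩

end BinomialBounds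

section Crowding

variable {Ω : Type*} [MeasurableSpace Ω] {μ : Measure Ω}

theorem measureReal_prodMk_mem_le_of_indepFun [IsProbabilityMeasure μ] {α β : Type*}
    [MeasurableSpace α] [MeasurableSpace β] {Y : Ω → α} {Z : Ω → β} (hYZ : IndepFun Y Z μ)
    (hY : Measurable Y) (hZ : Measurable Z) {Q : Set (α × β)} (hQ : MeasurableSet Q) {c : ℝ}
    (hc : ∀ y, μ.real {ω | (y, Z ω) ∈ Q} ≤ c) : μ.real {ω | (Y ω, Z ω) ∈ Q} ≤ c := by
  have : IsProbabilityMeasure (μ.map Y) := Measure.isProbabilityMeasure_map hY.aemeasurable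
  have hc0 : 0 ≤ c := by
    obtain ⟨ω⟩ := μ.nonempty_of_neZero
    exact measureReal_nonneg.trans (hc (Y ω))
  refine ENNReal.toReal_le_of_le_ofReal hc0 ?_
  calc μ {ω | (Y ω, Z ω) ∈ Q} = ((μ.map Y).prod (μ.map Z)) Q := by
        rw [← hYZ.map_prod_eq_prod_map_map hY.aemeasurable hZ.aemeasurable,
          Measure.map_apply (hY.prodMk hZ) hQ]
        rfl
    _ = ∫⁻ y, μ.map Z (Prod.mk y ⁻¹' Q) ∂μ.map Y := Measure.prod_apply hQ
    _ ≤ ∫⁻ _y, ENNReal.ofReal c ∂μ.map Y := by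
        refine lintegral_mono fun y => ?_
        rw [Measure.map_apply hZ (measurable_prodMk_left hQ)]
        exact (ENNReal.le_ofReal_iff_toReal_le (measure_ne_top _ _) hc0).2 (hc y)
    _ = ENNReal.ofReal c := by simp

variable {ι E : Type*} [MeasurableSpace E] [PseudoMetricSpace E] [OpensMeasurableSpace E]
  [SecondCountableTopology E] {X : ι → Ω → E} {I : Finset ι} {R b : ℝ}

theorem measureReal_le_pointCount_closedBall_le (hind : iIndepFun X μ)
    (hX : ∀ i, Measurable (X i))
    (hb : ∀ i ∈ I, ∀ y, μ.real (X i ⁻¹' Metric.closedBall y R) ≤ b) {a : ι} (ha : a ∉ I) (m : ℕ) :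
    μ.real {ω | m ≤ pointCount (X · ω) I (Metric.closedBall (X a ω) R)} ≤
      I.card.choose m * b ^ m := by
  have := hind.isProbabilityMeasure
  have hQ : MeasurableSet {z : E × (I → E) |
      m ≤ pointCount z.2 Finset.univ (Metric.closedBall z.1 R)} :=
    (measurable_pointCount fun i _ => by
      simp only [Metric.mem_closedBall]
      exact measurableSet_le (by fun_prop) measurable_const) measurableSet_Ici
  have h := measureReal_prodMk_mem_le_of_indepFun (indepFun_restrict_of_notMem hind hX ha) (hX a)
    (measurable_pi_lambda _ fun i => hX i) hQ (c := I.card.choose m * b ^ m) fun y => by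
      simpa only [Set.mem_ofPred_eq, pointCount_univ_restrict] using
        measureReal_le_pointCount_le hind Metric.isClosed_closedBall.measurableSet
          (fun i hi => hb i hi y) m
  simpa only [Set.mem_ofPred_eq, pointCount_univ_restrict] using h

theorem measureReal_exists_lt_pointCount_closedBall_le (hind : iIndepFun X μ)
    (hX : ∀ i, Measurable (X i)) (hb0 : 0 ≤ b)
    (hb : ∀ i ∈ I, ∀ y, μ.real (X i ⁻¹' Metric.closedBall y R) ≤ b) (m : ℕ) :
    μ.real {ω | ∃ a ∈ I, m < pointCount (X · ω) I (Metric.closedBall (X a ω) R)} ≤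
      I.card * (I.card.choose m * b ^ m) := by
  classical
  have := hind.isProbabilityMeasure
  have hsub : {ω | ∃ a ∈ I, m < pointCount (X · ω) I (Metric.closedBall (X a ω) R)} ⊆
      ⋃ a ∈ I, {ω | m ≤ pointCount (X · ω) (I.erase a) (Metric.closedBall (X a ω) R)} := by
    rintro ω ⟨a, ha, hm⟩
    refine Set.mem_biUnion ha (Nat.le_of_lt_succ (hm.trans_le ?_))
    conv_lhs => rw [← Finset.insert_erase ha]
    rw [pointCount_insert _ (Finset.notMem_erase a I), add_comm]
    exact Nat.add_le_add_left (Set.indicator_le_self _ _ _) _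
  calc _ ≤ ∑ a ∈ I, μ.real {ω | m ≤ pointCount (X · ω) (I.erase a)
          (Metric.closedBall (X a ω) R)} :=
        (measureReal_mono hsub (measure_ne_top _ _)).trans (measureReal_biUnion_finset_le _ _)
    _ ≤ ∑ _a ∈ I, (I.card.choose m * b ^ m : ℝ) := by
        refine Finset.sum_le_sum fun a _ => (measureReal_le_pointCount_closedBall_le hind hX
          (fun i hi => hb i (Finset.mem_of_mem_erase hi)) (Finset.notMem_erase a I) m).trans ?_
        gcongr
        exact Finset.erase_subset a I
    _ = _ := by simp

end Crowding

theorem ae_eventually_notMem_of_eventually_le {Ω : Type*} [MeasurableSpace Ω] {μ : Measure Ω}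
    [IsFiniteMeasure μ] {s : ℕ → Set Ω} {g : ℕ → ℝ} (hg : Summable g)
    (h : ∀ᶠ n in atTop, μ.real (s n) ≤ g n) : ∀ᵐ ω ∂μ, ∀ᶠ n in atTop, ω ∉ s n := by
  have hs : Summable fun n => μ.real (s n) := by
    refine Summable.of_norm_bounded_eventually_nat hg ?_
    filter_upwards [h] with n hn
    rwa [Real.norm_of_nonneg measureReal_nonneg]
  have hofReal : ∑' n, ENNReal.ofReal (μ.real (s n)) = ∑' n, μ (s n) :=
    tsum_congr fun n => ofReal_measureReal
  exact ae_eventually_notMem (hofReal ▸ hs.tsum_ofReal_ne_top)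

section UniformCrowding

theorem choose_le_exp_mul_div_pow (n m : ℕ) :
    (n.choose m : ℝ) ≤ (Real.exp 1 * n / m) ^ m := by
  rcases Nat.eq_zero_or_pos m with rfl | hm
  · simp
  have hexp : (m : ℝ) ^ m / m.factorial ≤ Real.exp 1 ^ m := by
    simpa [← Real.exp_nat_mul] using Real.pow_div_factorial_le_exp (m : ℝ) m.cast_nonneg m
  calc (n.choose m : ℝ) ≤ (n : ℝ) ^ m / m.factorial := Nat.choose_le_pow_div m n
    _ = (n / m : ℝ) ^ m * ((m : ℝ) ^ m / m.factorial) := by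
      rw [div_pow]
      field_simp
    _ ≤ (n / m : ℝ) ^ m * Real.exp 1 ^ m := by gcongr
    _ = (Real.exp 1 * n / m) ^ m := by rw [← mul_pow]; ring

theorem exists_nonneg_mul_pow_eq {a t : ℝ} (ha : 0 < a) (ht : 0 ≤ t) {k : ℕ} (hk : k ≠ 0) :
    ∃ ρ, 0 ≤ ρ ∧ a * ρ ^ k = t :=
  ⟨(t / a) ^ (k⁻¹ : ℝ), by positivity, by
    rw [Real.rpow_inv_natCast_pow (by positivity) hk, mul_div_cancel₀ _ ha.ne']⟩

variable {Ω ι E : Type*} [MeasurableSpace Ω] {μ : Measure Ω} [MeasurableSpace E]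
  [PseudoMetricSpace E] [OpensMeasurableSpace E] [SecondCountableTopology E] {C : ℝ} {d : ℕ}

theorem measureReal_exists_lt_pointCount_closedBall_le_exp {X : ι → Ω → E} (hind : iIndepFun X μ)
    (hX : ∀ i, Measurable (X i)) (hC : 0 < C)
    (hball : ∀ i y s, 0 ≤ s → μ.real (X i ⁻¹' Metric.closedBall y s) ≤ C * s ^ d)
    (I : Finset ι) (m : ℕ) {R : ℝ} (hR : 0 ≤ R) :
    μ.real {ω | ∃ a ∈ I, m < pointCount (X · ω) I (Metric.closedBall (X a ω) R)} ≤
      I.card * (Real.exp 1 * C * I.card * R ^ d / m) ^ m := by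
  refine (measureReal_exists_lt_pointCount_closedBall_le hind hX (by positivity)
    (fun i _ y => hball i y R hR) m).trans (mul_le_mul_of_nonneg_left ?_ (Nat.cast_nonneg _))
  calc I.card.choose m * (C * R ^ d) ^ m
      ≤ (Real.exp 1 * I.card / m) ^ m * (C * R ^ d) ^ m := by
        gcongr
        exact choose_le_exp_mul_div_pow _ _
    _ = (Real.exp 1 * C * I.card * R ^ d / m) ^ m := by rw [← mul_pow]; ring

/-- Since the event grows with the radius, all radii together cost no more than the largest one. -/
theorem measureReal_exists_radius_lt_pointCount_closedBall_le {X : ι → Ω → E}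
    (hind : iIndepFun X μ) (hX : ∀ i, Measurable (X i)) (hC : 0 < C) (hd : d ≠ 0)
    (hball : ∀ i y s, 0 ≤ s → μ.real (X i ⁻¹' Metric.closedBall y s) ≤ C * s ^ d)
    (I : Finset ι) {m : ℕ} (hm : m ≠ 0) {t : ℝ} (ht : 0 ≤ t) :
    μ.real {ω | ∃ R, 0 ≤ R ∧ I.card * (Real.exp 1 * C * I.card * R ^ d / m) ^ m ≤ t ∧
      ∃ a ∈ I, m < pointCount (X · ω) I (Metric.closedBall (X a ω) R)} ≤ t := by
  have := hind.isProbabilityMeasure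
  rcases I.eq_empty_or_nonempty with rfl | hI
  · simpa using ht
  have hN : (0 : ℝ) < I.card := by exact_mod_cast hI.card_pos
  have hm0 : (0 : ℝ) < m := by exact_mod_cast Nat.pos_of_ne_zero hm
  have hbound : ∀ R : ℝ, I.card * (Real.exp 1 * C * I.card * R ^ d / m) ^ m =
      I.card * (Real.exp 1 * C * I.card / m) ^ m * R ^ (d * m) := fun R => by
    rw [mul_div_right_comm, mul_pow, ← pow_mul, ← mul_assoc]
  simp only [hbound]
  obtain ⟨ρ, hρ, hρt⟩ := exists_nonneg_mul_pow_eq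
    (a := I.card * (Real.exp 1 * C * I.card / m) ^ m) (by positivity) ht (mul_ne_zero hd hm)
  refine (measureReal_mono ?_ (measure_ne_top _ _)).trans
    ((measureReal_exists_lt_pointCount_closedBall_le_exp hind hX hC hball I m hρ).trans_eq
      ((hbound ρ).trans hρt))
  rintro ω ⟨R, hR, hRt, a, ha, hlt⟩
  have hRρ : R ≤ ρ := le_of_pow_le_pow_left₀ (mul_ne_zero hd hm) hρ <|
    le_of_mul_le_mul_left (hRt.trans_eq hρt.symm) (by positivity)
  exact ⟨a, ha, hlt.trans_le
    (pointCount_mono _ subset_rfl (Metric.closedBall_subset_closedBall hRρ))⟩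

theorem summable_succ_mul_two_mul_rpow_neg_pow {δ : ℝ} (hδ : 0 < δ) :
    Summable fun j : ℕ => ((j + 1 : ℕ) : ℝ) * (2 * ((2 : ℝ) ^ (-δ)) ^ j) := by
  have hlt : ‖(2 : ℝ) ^ (-δ)‖ < 1 := by
    rw [Real.norm_of_nonneg (by positivity)]
    exact Real.rpow_lt_one_of_one_lt_of_neg one_lt_two (neg_lt_zero.2 hδ)
  refine (((summable_pow_mul_geometric_of_norm_lt_one 1 hlt).add
    (summable_geometric_of_norm_lt_one hlt)).mul_left 2).congr fun j => ?_
  push_cast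
  ring

theorem tendsto_natLog_atTop {b : ℕ} (hb : 1 < b) : Tendsto (Nat.log b) atTop atTop :=
  tendsto_atTop_atTop_of_monotone (fun _ _ => Nat.log_mono_right) fun j =>
    ⟨b ^ j, (Nat.log_pow hb j).ge⟩

variable {X : ℕ → Ω → E}

theorem ae_eventually_dyadic_pointCount_closedBall_le (hind : iIndepFun X μ)
    (hX : ∀ i, Measurable (X i)) (hC : 0 < C) (hd : d ≠ 0)
    (hball : ∀ i y s, 0 ≤ s → μ.real (X i ⁻¹' Metric.closedBall y s) ≤ C * s ^ d)
    {δ : ℝ} (hδ : 0 < δ) :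
    ∀ᵐ ω ∂μ, ∀ᶠ j : ℕ in atTop, ∀ m : ℕ, m ≠ 0 → m ≤ j + 1 → ∀ R : ℝ, 0 ≤ R →
      (2 ^ (j + 1) : ℝ) * (Real.exp 1 * C * 2 ^ (j + 1) * R ^ d / m) ^ m ≤
        2 * ((2 : ℝ) ^ (-δ)) ^ j →
      ∀ v < 2 ^ (j + 1), pointCount (X · ω) (Finset.range (2 ^ (j + 1)))
        (Metric.closedBall (X v ω) R) ≤ m := by
  have := hind.isProbabilityMeasure
  let I : ℕ → Finset ℕ := fun j => Finset.range (2 ^ (j + 1))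
  let B : ℕ → ℕ → Set Ω := fun j m => {ω | ∃ R : ℝ, 0 ≤ R ∧
    (I j).card * (Real.exp 1 * C * (I j).card * R ^ d / m) ^ m ≤ 2 * ((2 : ℝ) ^ (-δ)) ^ j ∧
      ∃ v ∈ I j, m < pointCount (X · ω) (I j) (Metric.closedBall (X v ω) R)}
  have hB : ∀ j, μ.real (⋃ m ∈ Finset.Icc 1 (j + 1), B j m) ≤
      ((j + 1 : ℕ) : ℝ) * (2 * ((2 : ℝ) ^ (-δ)) ^ j) := fun j => by
    calc μ.real (⋃ m ∈ Finset.Icc 1 (j + 1), B j m)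
        ≤ ∑ m ∈ Finset.Icc 1 (j + 1), μ.real (B j m) := measureReal_biUnion_finset_le _ _
      _ ≤ ∑ _m ∈ Finset.Icc 1 (j + 1), 2 * ((2 : ℝ) ^ (-δ)) ^ j :=
          Finset.sum_le_sum fun m hm => measureReal_exists_radius_lt_pointCount_closedBall_le hind
            hX hC hd hball (I j) (Nat.one_le_iff_ne_zero.1 (Finset.mem_Icc.1 hm).1) (by positivity)
      _ = _ := by simp
  filter_upwards [ae_eventually_notMem_of_eventually_le
    (summable_succ_mul_two_mul_rpow_neg_pow hδ) (Eventually.of_forall hB)] with ω hω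
  filter_upwards [hω] with j hj m hm0 hmj R hR hRm v hv
  by_contra! hlt
  refine hj (Set.mem_biUnion (Finset.mem_Icc.2 ⟨Nat.one_le_iff_ne_zero.2 hm0, hmj⟩)
    ⟨R, hR, ?_, v, Finset.mem_range.2 hv, hlt⟩)
  simpa [I] using hRm

/-- Interpolates between powers of two: for `2 ^ j ≤ n < 2 ^ (j + 1)`, the first `n` points are
among the first `2 ^ (j + 1) ≤ 2 n`. -/
theorem ae_eventually_pointCount_closedBall_le (hind : iIndepFun X μ)
    (hX : ∀ i, Measurable (X i)) (hC : 0 < C) (hd : d ≠ 0)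
    (hball : ∀ i y s, 0 ≤ s → μ.real (X i ⁻¹' Metric.closedBall y s) ≤ C * s ^ d)
    {δ : ℝ} (hδ : 0 < δ) :
    ∀ᵐ ω ∂μ, ∀ᶠ n : ℕ in atTop, ∀ m : ℕ, m ≠ 0 → (m : ℝ) ≤ Real.log n → ∀ R : ℝ, 0 ≤ R →
      n * (2 * Real.exp 1 * C * (n * R ^ d) / m) ^ m ≤ (n : ℝ) ^ (-δ) →
      ∀ v < n, pointCount (X · ω) (Finset.range n) (Metric.closedBall (X v ω) R) ≤ m := by
  filter_upwards [ae_eventually_dyadic_pointCount_closedBall_le hind hX hC hd hball hδ] with ω hω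
  filter_upwards [(tendsto_natLog_atTop one_lt_two).eventually hω, eventually_gt_atTop 0]
    with n hdyadic hn m hm0 hmn R hR hRm v hv
  set j := Nat.log 2 n
  have hjn : 2 ^ j ≤ n := Nat.pow_log_le_self 2 hn.ne'
  have hnj : n < 2 ^ (j + 1) := Nat.lt_pow_succ_log_self one_lt_two n
  have hjn' : (2 : ℝ) ^ j ≤ n := by exact_mod_cast hjn
  have hmj : m ≤ j + 1 := by
    have hlog : Real.log n ≤ ((j + 1 : ℕ) : ℝ) := by
      calc Real.log n ≤ Real.log (2 ^ (j + 1)) :=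
            Real.log_le_log (by exact_mod_cast hn) (by exact_mod_cast hnj.le)
        _ = ((j + 1 : ℕ) : ℝ) * Real.log 2 := by rw [Real.log_pow]
        _ ≤ ((j + 1 : ℕ) : ℝ) := mul_le_of_le_one_right (Nat.cast_nonneg _)
            (Real.log_two_lt_d9.le.trans (by norm_num))
    exact_mod_cast hmn.trans hlog
  have hblock : (2 ^ (j + 1) : ℝ) * (Real.exp 1 * C * 2 ^ (j + 1) * R ^ d / m) ^ m ≤
      2 * ((2 : ℝ) ^ (-δ)) ^ j := by
    calc (2 ^ (j + 1) : ℝ) * (Real.exp 1 * C * 2 ^ (j + 1) * R ^ d / m) ^ m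
        = 2 * (2 ^ j * (2 * Real.exp 1 * C * (2 ^ j * R ^ d) / m) ^ m) := by
          rw [pow_succ]; ring_nf
      _ ≤ 2 * (n * (2 * Real.exp 1 * C * (n * R ^ d) / m) ^ m) := by gcongr
      _ ≤ 2 * (n : ℝ) ^ (-δ) := by gcongr
      _ ≤ 2 * ((2 : ℝ) ^ j) ^ (-δ) := mul_le_mul_of_nonneg_left
          (Real.rpow_le_rpow_of_nonpos (by positivity) hjn' (neg_nonpos.2 hδ.le)) two_pos.le
      _ = 2 * ((2 : ℝ) ^ (-δ)) ^ j := by rw [Real.rpow_pow_comm two_pos.le]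
  exact (pointCount_mono _ (Finset.range_mono hnj.le) subset_rfl).trans
    (hdyadic m hm0 hmj R hR hblock v (hv.trans hnj))

end UniformCrowding

section Asymptotics

/-- The regime of the theorem for the expected number `a n = n * r n ^ d` of points in a cube of
side `r n`: below the connectivity threshold `log n`, but larger than every power `n ^ (-ε)`. -/
structure SubconnectivityRegime (a : ℕ → ℝ) : Prop where
  nonneg : ∀ n, 0 ≤ a n
  rpow_neg_isLittleO : ∀ ε : ℝ, 0 < ε → (fun n : ℕ => (n : ℝ) ^ (-ε)) =o[atTop] a
  isLittleO_log : a =o[atTop] fun n : ℕ => Real.log n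

/-- The common first-order asymptotics of both chromatic numbers: the number of points in the most
crowded set of diameter of order `r n`, where `a n = n * r n ^ d`. -/
noncomputable def clusterSize (a : ℕ → ℝ) (n : ℕ) : ℝ :=
  Real.log n / Real.log (Real.log n / a n)

theorem div_pow_eq_exp {x y : ℝ} (hx : 0 < x) (hy : 0 < y) (m : ℕ) :
    (x / y) ^ m = Real.exp (-(m * Real.log (y / x))) := by
  rw [← mul_neg, ← Real.log_inv, inv_div, Real.exp_nat_mul, Real.exp_log (by positivity)]

theorem tendsto_log_natCast_atTop : Tendsto (fun n : ℕ => Real.log n) atTop atTop :=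
  Real.tendsto_log_atTop.comp tendsto_natCast_atTop_atTop

theorem tendsto_sub_log_sub_div_atTop (b : ℝ) :
    Tendsto (fun x : ℝ => (x - Real.log x - b) / x) atTop (𝓝 1) := by
  have hlim : Tendsto (fun x : ℝ => 1 - Real.log x / x - b / x) atTop (𝓝 (1 - 0 - 0)) :=
    (tendsto_const_nhds.sub Real.isLittleO_log_id_atTop.tendsto_div_nhds_zero).sub
      (tendsto_const_nhds.div_atTop tendsto_id)
  rw [sub_zero, sub_zero] at hlim
  refine hlim.congr' ?_
  filter_upwards [eventually_gt_atTop 0] with x hx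
  field_simp

namespace SubconnectivityRegime

variable {a : ℕ → ℝ} (ha : SubconnectivityRegime a)
include ha

theorem eventually_rpow_neg_le {ε : ℝ} (hε : 0 < ε) : ∀ᶠ n : ℕ in atTop, (n : ℝ) ^ (-ε) ≤ a n := by
  filter_upwards [(ha.rpow_neg_isLittleO ε hε).bound one_pos] with n hn
  rwa [one_mul, Real.norm_of_nonneg (by positivity), Real.norm_of_nonneg (ha.nonneg n)] at hn

theorem eventually_pos : ∀ᶠ n in atTop, 0 < a n := by
  filter_upwards [ha.eventually_rpow_neg_le one_pos, eventually_gt_atTop 0] with n hn hn0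
  exact (Real.rpow_pos_of_pos (by exact_mod_cast hn0) _).trans_le hn

theorem eventually_le_mul_log {δ : ℝ} (hδ : 0 < δ) : ∀ᶠ n : ℕ in atTop, a n ≤ δ * Real.log n := by
  filter_upwards [ha.isLittleO_log.bound hδ] with n hn
  rwa [Real.norm_of_nonneg (ha.nonneg n), Real.norm_of_nonneg (Real.log_natCast_nonneg n)] at hn

theorem tendsto_log_div_atTop : Tendsto (fun n : ℕ => Real.log n / a n) atTop atTop := by
  have hpos : ∀ᶠ n : ℕ in atTop, 0 < a n / Real.log n := by
    filter_upwards [ha.eventually_pos, tendsto_log_natCast_atTop.eventually_gt_atTop 0]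
      with n h₁ h₂
    exact div_pos h₁ h₂
  refine (tendsto_inv_nhdsGT_zero.comp
    (tendsto_nhdsWithin_iff.2 ⟨ha.isLittleO_log.tendsto_div_nhds_zero, hpos⟩)).congr fun n => ?_
  exact inv_div _ _

theorem tendsto_log_log_div_atTop :
    Tendsto (fun n : ℕ => Real.log (Real.log n / a n)) atTop atTop :=
  Real.tendsto_log_atTop.comp ha.tendsto_log_div_atTop

theorem eventually_log_log_div_le {δ : ℝ} (hδ : 0 < δ) :
    ∀ᶠ n : ℕ in atTop, Real.log (Real.log n / a n) ≤ δ * Real.log n := by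
  filter_upwards [ha.eventually_rpow_neg_le (half_pos hδ), ha.eventually_pos,
    tendsto_log_natCast_atTop.eventually_gt_atTop 0,
    (Real.isLittleO_log_id_atTop.comp_tendsto tendsto_log_natCast_atTop).bound (half_pos hδ),
    eventually_gt_atTop 0] with n hrpow han hlog hloglog hn
  have hloga : -(δ / 2) * Real.log n ≤ Real.log (a n) := by
    have hn' : (0 : ℝ) < n := by exact_mod_cast hn
    rw [← Real.log_rpow hn']
    exact Real.log_le_log (by positivity) hrpow
  have hloglog' : Real.log (Real.log n) ≤ δ / 2 * Real.log n := by
    simpa [abs_of_pos hlog] using (le_abs_self _).trans hloglog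
  rw [Real.log_div hlog.ne' han.ne']
  linarith

theorem tendsto_clusterSize_atTop : Tendsto (clusterSize a) atTop atTop := by
  refine tendsto_atTop.2 fun K => ?_
  filter_upwards [ha.eventually_log_log_div_le (δ := (max K 1)⁻¹) (by positivity),
    ha.tendsto_log_log_div_atTop.eventually_gt_atTop 0] with n hle hpos
  have hK : 0 < max K 1 := by positivity
  calc K ≤ max K 1 := le_max_left _ _
    _ ≤ clusterSize a n := by
      rwa [clusterSize, le_div_iff₀ hpos, ← le_inv_mul_iff₀ hK]

theorem tendsto_clusterSize_div_log :
    Tendsto (fun n : ℕ => clusterSize a n / Real.log n) atTop (𝓝 0) := by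
  refine ha.tendsto_log_log_div_atTop.inv_tendsto_atTop.congr' ?_
  filter_upwards [tendsto_log_natCast_atTop.eventually_gt_atTop 0] with n hn
  rw [Pi.inv_apply, clusterSize, div_div_cancel_left' hn.ne']

theorem tendsto_clusterSize_mul_log_div_log {C : ℝ} (hC : 0 < C) :
    Tendsto (fun n : ℕ => clusterSize a n * Real.log (clusterSize a n / (C * a n)) / Real.log n)
      atTop (𝓝 1) := by
  refine ((tendsto_sub_log_sub_div_atTop (Real.log C)).comp
    ha.tendsto_log_log_div_atTop).congr' ?_
  filter_upwards [ha.eventually_pos, ha.tendsto_log_log_div_atTop.eventually_gt_atTop 0,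
    tendsto_log_natCast_atTop.eventually_gt_atTop 0] with n han hlogL hlog
  have hL : Real.log n / a n ≠ 0 := (div_pos hlog han).ne'
  have hratio : clusterSize a n / (C * a n) =
      Real.log n / a n / Real.log (Real.log n / a n) / C := by
    rw [clusterSize]; field_simp
  rw [Function.comp_apply, hratio, Real.log_div (div_ne_zero hL hlogL.ne') hC.ne',
    Real.log_div hL hlogL.ne', clusterSize]
  field_simp

theorem eventually_log_clusterSize_div_nonneg {C : ℝ} (hC : 0 < C) :
    ∀ᶠ n in atTop, 0 ≤ Real.log (clusterSize a n / (C * a n)) := by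
  filter_upwards [(ha.tendsto_clusterSize_mul_log_div_log hC).eventually_const_lt one_pos,
    ha.tendsto_clusterSize_atTop.eventually_gt_atTop 0,
    tendsto_log_natCast_atTop.eventually_gt_atTop 0] with n hn hk hlog
  exact (pos_of_mul_pos_right ((div_pos_iff_of_pos_right hlog).1 hn) hk.le).le

theorem eventually_div_pow_le_rpow_neg {θ η C : ℝ} (hC : 0 < C) (hθ : 1 ≤ θ) (hηθ : η < θ) :
    ∀ᶠ n : ℕ in atTop, ∀ m : ℕ, θ * clusterSize a n ≤ m →
      (C * a n / m) ^ m ≤ (n : ℝ) ^ (-η) := by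
  have hlim := (ha.tendsto_clusterSize_mul_log_div_log hC).const_mul θ
  rw [mul_one] at hlim
  filter_upwards [hlim.eventually_const_le hηθ, ha.eventually_pos,
    ha.tendsto_clusterSize_atTop.eventually_gt_atTop 0, eventually_gt_atTop 0,
    ha.eventually_log_clusterSize_div_nonneg hC,
    tendsto_log_natCast_atTop.eventually_gt_atTop 0] with n hη han hk hn hlogk hlog m hm
  have hkm : clusterSize a n ≤ m := (le_mul_of_one_le_left hk.le hθ).trans hm
  have hm0 : (0 : ℝ) < m := hk.trans_le hkm
  rw [← mul_div_assoc, le_div_iff₀ hlog] at hη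
  rw [div_pow_eq_exp (by positivity) hm0, Real.rpow_def_of_pos (by exact_mod_cast hn)]
  rw [mul_neg, mul_comm (Real.log n)]
  refine Real.exp_le_exp.2 (neg_le_neg ?_)
  calc η * Real.log n
      ≤ θ * (clusterSize a n * Real.log (clusterSize a n / (C * a n))) := hη
    _ = θ * clusterSize a n * Real.log (clusterSize a n / (C * a n)) := by ring
    _ ≤ m * Real.log (clusterSize a n / (C * a n)) := by gcongr
    _ ≤ m * Real.log (m / (C * a n)) := by gcongr

theorem eventually_rpow_neg_le_div_pow_mul_exp {θ η c C : ℝ} (hc : 0 < c) (hC : 0 < C)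
    (hθ : θ ≤ 1) (hθη : θ < η) :
    ∀ᶠ n : ℕ in atTop, ∀ m : ℕ, m ≠ 0 → m ≤ θ * clusterSize a n →
      (n : ℝ) ^ (-η) ≤ (c * a n / m) ^ m * Real.exp (-(C * a n)) := by
  obtain ⟨ζ, hθζ, hζη⟩ := exists_between hθη
  have hlim := (ha.tendsto_clusterSize_mul_log_div_log hc).const_mul θ
  rw [mul_one] at hlim
  filter_upwards [hlim.eventually_le_const hθζ, ha.eventually_pos,
    ha.tendsto_clusterSize_atTop.eventually_gt_atTop 0, eventually_gt_atTop 0,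
    ha.eventually_log_clusterSize_div_nonneg hc,
    ha.eventually_le_mul_log (div_pos (sub_pos.2 hζη) hC),
    tendsto_log_natCast_atTop.eventually_gt_atTop 0] with n hζ han hk hn hlogk halog hlog m hm hmk
  have hm0 : (0 : ℝ) < m := by exact_mod_cast Nat.pos_of_ne_zero hm
  have hmk' : m ≤ clusterSize a n := hmk.trans (mul_le_of_le_one_left hk.le hθ)
  rw [← mul_div_assoc, div_le_iff₀ hlog] at hζ
  rw [div_mul_eq_mul_div, le_div_iff₀ hC] at halog
  rw [div_pow_eq_exp (by positivity) hm0, ← Real.exp_add,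
    Real.rpow_def_of_pos (by exact_mod_cast hn)]
  have hmlog : m * Real.log (m / (c * a n)) ≤ ζ * Real.log n := by
    calc m * Real.log (m / (c * a n))
        ≤ m * Real.log (clusterSize a n / (c * a n)) := by gcongr
      _ ≤ θ * clusterSize a n * Real.log (clusterSize a n / (c * a n)) := by gcongr
      _ ≤ ζ * Real.log n := (mul_assoc _ _ _).trans_le hζ
  exact Real.exp_le_exp.2 (by linarith)

theorem eventually_two_mul_log_le_rpow_div {c δ : ℝ} (hc : 0 < c) (hδ : 0 < δ) :
    ∀ᶠ n : ℕ in atTop, 2 * Real.log n ≤ c * (n : ℝ) ^ δ / a n := by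
  have hlogsq : (fun n : ℕ => Real.log n * a n) =o[atTop] fun n : ℕ => (n : ℝ) ^ δ := by
    have hlog : (fun n : ℕ => Real.log n) =o[atTop] fun n : ℕ => (n : ℝ) ^ (δ / 2) :=
      (isLittleO_log_rpow_atTop (half_pos hδ)).comp_tendsto tendsto_natCast_atTop_atTop
    refine (hlog.mul (ha.isLittleO_log.trans hlog)).congr_right fun n => ?_
    rw [← Real.rpow_add_of_nonneg n.cast_nonneg (half_pos hδ).le (half_pos hδ).le, add_halves]
  filter_upwards [hlogsq.bound (half_pos hc), ha.eventually_pos] with n hn han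
  rw [Real.norm_of_nonneg (mul_nonneg (Real.log_natCast_nonneg n) han.le),
    Real.norm_of_nonneg (by positivity)] at hn
  rw [le_div_iff₀ han]
  linarith

theorem eventually_two_mul_log_le_occupancy {θ c C c' : ℝ} (hc : 0 < c) (hC : 0 < C)
    (hc' : 0 < c') (hθ : θ < 1) :
    ∀ᶠ n : ℕ in atTop, ∀ m : ℕ, m ≠ 0 → m ≤ θ * clusterSize a n →
      2 * Real.log n ≤ (c * a n / m) ^ m * Real.exp (-(C * a n)) * (c' * n / a n) := by
  obtain ⟨η, hθη, hη⟩ := exists_between hθ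
  filter_upwards [ha.eventually_rpow_neg_le_div_pow_mul_exp hc hC hθ.le hθη,
    ha.eventually_two_mul_log_le_rpow_div hc' (sub_pos.2 hη), ha.eventually_pos,
    eventually_gt_atTop 0] with n hrpow hlog han hn m hm hmk
  calc 2 * Real.log n ≤ c' * (n : ℝ) ^ (1 - η) / a n := hlog
    _ = (n : ℝ) ^ (-η) * (c' * n / a n) := by
      rw [sub_eq_neg_add, Real.rpow_add_one (by exact_mod_cast hn.ne')]
      ring
    _ ≤ _ := mul_le_mul_of_nonneg_right (hrpow m hm hmk) (by positivity)

theorem eventually_mul_clusterSize_le_log (K : ℝ) :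
    ∀ᶠ n : ℕ in atTop, K * clusterSize a n ≤ Real.log n := by
  have hlim := ha.tendsto_clusterSize_div_log.const_mul K
  rw [mul_zero] at hlim
  filter_upwards [hlim.eventually_le_const one_pos,
    tendsto_log_natCast_atTop.eventually_gt_atTop 0] with n hn hlog
  rwa [← mul_div_assoc, div_le_one hlog] at hn

end SubconnectivityRegime

end Asymptotics

section Cubes

variable {d : ℕ}

theorem measurableSet_gridCube (s : ℝ) (z : Fin d → ℤ) : MeasurableSet (gridCube s z) := by
  have h : gridCube s z = ⋂ i, {x : Fin d → ℝ | ⌊x i / s⌋ = z i} := by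
    ext
    simp [gridCube]
  rw [h]
  exact MeasurableSet.iInter fun i =>
    (Int.measurable_floor.comp (by fun_prop)) (measurableSet_singleton (z i))

theorem pairwise_disjoint_gridCube (s : ℝ) :
    Pairwise (Function.onFun Disjoint (gridCube s : (Fin d → ℤ) → Set (Fin d → ℝ))) :=
  fun _ _ hz => Set.disjoint_left.2 fun _ hx hx' =>
    hz (funext fun i => (hx i).symm.trans (hx' i))

theorem closedBall_zero_subset_iUnion_gridCube {R s : ℝ} (hs : 0 < s) :
    Metric.closedBall (0 : Fin d → ℝ) R ⊆
      ⋃ z ∈ Finset.Icc (fun _ => ⌊-R / s⌋) fun _ => ⌊R / s⌋, gridCube s z := by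
  intro x hx
  have hxi : ∀ i, |x i| ≤ R := fun i => (norm_le_pi_norm x i).trans (by simpa using hx)
  refine Set.mem_biUnion (x := fun i => ⌊x i / s⌋) ?_ fun i => rfl
  refine Finset.mem_coe.2 (Finset.mem_Icc.2 ⟨fun i => ?_, fun i => ?_⟩) <;>
    refine Int.floor_mono ?_ <;> gcongr
  · exact (abs_le.1 (hxi i)).1
  · exact (abs_le.1 (hxi i)).2

theorem card_Icc_floor_mul_pow_le {R s : ℝ} (hR : 0 ≤ R) (hs : 0 < s) :
    ((Finset.Icc (fun _ : Fin d => ⌊-R / s⌋) fun _ => ⌊R / s⌋).card : ℝ) * s ^ d ≤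
      (2 * R + 2 * s) ^ d := by
  have hfloor : ⌊-R / s⌋ ≤ ⌊R / s⌋ + 1 := by
    refine (Int.floor_mono ?_).trans (Int.le_add_one le_rfl)
    gcongr
    linarith
  have hcard : ((Finset.Icc ⌊-R / s⌋ ⌊R / s⌋).card : ℝ) * s ≤ 2 * R + 2 * s := by
    calc ((Finset.Icc ⌊-R / s⌋ ⌊R / s⌋).card : ℝ) * s = (⌊R / s⌋ + 1 - ⌊-R / s⌋) * s := by
          rw [← Int.cast_natCast, Int.card_Icc_of_le _ _ hfloor]
          push_cast
          ring
      _ ≤ (R / s + 1 - (-R / s - 1)) * s := by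
          gcongr
          · exact Int.floor_le _
          · exact (Int.sub_one_lt_floor _).le
      _ = 2 * R + 2 * s := by field_simp; ring
  calc ((Finset.Icc (fun _ : Fin d => ⌊-R / s⌋) fun _ => ⌊R / s⌋).card : ℝ) * s ^ d
      = (((Finset.Icc ⌊-R / s⌋ ⌊R / s⌋).card : ℝ) * s) ^ d := by simp [Pi.card_Icc, mul_pow]
    _ ≤ (2 * R + 2 * s) ^ d := by gcongr

theorem sum_le_card_filter_le_mul_add {κ : Type*} {Z : Finset κ} {w : κ → ℝ} {b t : ℝ}
    (hw : ∀ z ∈ Z, w z ≤ b) (ht : 0 ≤ t) :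
    ∑ z ∈ Z, w z ≤ (Z.filter fun z => t ≤ w z).card * b + Z.card * t := by
  calc ∑ z ∈ Z, w z ≤ ∑ z ∈ Z, ((if t ≤ w z then b else 0) + t) := by
        refine Finset.sum_le_sum fun z hz => ?_
        split_ifs with h
        · exact (hw z hz).trans (le_add_of_nonneg_right ht)
        · simpa using (not_le.1 h).le
    _ = (Z.filter fun z => t ≤ w z).card * b + Z.card * t := by
        rw [Finset.sum_add_distrib, ← Finset.sum_filter]
        simp

theorem exists_half_le_measureReal_closedBall {E : Type*} [PseudoMetricSpace E]
    [MeasurableSpace E] (ν : Measure E) [IsProbabilityMeasure ν] (x : E) :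
    ∃ R, 0 ≤ R ∧ 1 / 2 ≤ ν.real (Metric.closedBall x R) := by
  have hmono : Monotone fun n : ℕ => Metric.closedBall x n := fun _ _ hab =>
    Metric.closedBall_subset_closedBall (by exact_mod_cast hab)
  have hlim := tendsto_measure_iUnion_atTop (μ := ν) hmono
  rw [Metric.iUnion_closedBall_nat, measure_univ] at hlim
  have hlim' : Tendsto (fun n : ℕ => ν.real (Metric.closedBall x n)) atTop (𝓝 1) :=
    (ENNReal.tendsto_toReal ENNReal.one_ne_top).comp hlim
  obtain ⟨n, hn⟩ := (hlim'.eventually_const_le one_half_lt_one).exists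
  exact ⟨n, n.cast_nonneg, hn⟩

theorem exists_measureReal_withDensity_closedBall_le {f : (Fin d → ℝ) → ℝ}
    (hf : ∃ M : ℝ, ∀ᵐ x, f x ≤ M) :
    ∃ C > 0, ∀ (y : Fin d → ℝ) (s : ℝ), 0 ≤ s →
      (volume.withDensity fun x => ENNReal.ofReal (f x)).real (Metric.closedBall y s) ≤
        C * s ^ d := by
  obtain ⟨M, hM⟩ := hf
  refine ⟨max M 1 * 2 ^ d, by positivity, fun y s hs => ?_⟩
  refine ENNReal.toReal_le_of_le_ofReal (by positivity) ?_
  calc (volume.withDensity fun x => ENNReal.ofReal (f x)) (Metric.closedBall y s)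
      = ∫⁻ x in Metric.closedBall y s, ENNReal.ofReal (f x) :=
        withDensity_apply _ Metric.isClosed_closedBall.measurableSet
    _ ≤ ∫⁻ _x in Metric.closedBall y s, ENNReal.ofReal (max M 1) := by
        refine lintegral_mono_ae (ae_restrict_of_ae ?_)
        filter_upwards [hM] with x hx
        exact ENNReal.ofReal_le_ofReal (hx.trans (le_max_left _ _))
    _ = ENNReal.ofReal (max M 1 * 2 ^ d * s ^ d) := by
        rw [setLIntegral_const, Real.volume_pi_closedBall y hs, Fintype.card_fin,
          ← ENNReal.ofReal_mul (by positivity), mul_pow, mul_assoc]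

variable {ν : Measure (Fin d → ℝ)} [IsProbabilityMeasure ν] {C : ℝ}

theorem measureReal_gridCube_le (hC : 0 ≤ C)
    (hball : ∀ y s, 0 ≤ s → ν.real (Metric.closedBall y s) ≤ C * s ^ d) {s : ℝ} (hs : 0 < s)
    (z : Fin d → ℤ) : ν.real (gridCube s z) ≤ C * s ^ d := by
  rcases (gridCube s z).eq_empty_or_nonempty with h | ⟨y, hy⟩
  · rw [h, measureReal_empty]
    positivity
  · exact (measureReal_mono fun x hx => dist_le_of_mem_gridCube hs hx hy).trans (hball y s hs.le)

/-- A bounded region of mass at least `1 / 2` is covered by `O(s⁻ᵈ)` cubes, each of mass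
`O(sᵈ)`, so that a positive proportion of them has mass of order exactly `sᵈ`. -/
theorem exists_finset_le_measureReal_gridCube (hC : 0 < C)
    (hball : ∀ y s, 0 ≤ s → ν.real (Metric.closedBall y s) ≤ C * s ^ d) :
    ∃ c > 0, ∃ c' > 0, ∀ s : ℝ, 0 < s → s ≤ 1 → ∃ T : Finset (Fin d → ℤ),
      c' ≤ T.card * s ^ d ∧ ∀ z ∈ T, c * s ^ d ≤ ν.real (gridCube s z) := by
  obtain ⟨R, hR, hRν⟩ := exists_half_le_measureReal_closedBall ν 0
  set c : ℝ := 1 / (4 * (2 * R + 2) ^ d) with hc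
  refine ⟨c, by positivity, 1 / (4 * C), by positivity, fun s hs hs1 => ?_⟩
  let Z : Finset (Fin d → ℤ) := Finset.Icc (fun _ => ⌊-R / s⌋) fun _ => ⌊R / s⌋
  let T := Z.filter fun z => c * s ^ d ≤ ν.real (gridCube s z)
  refine ⟨T, ?_, fun z hz => (Finset.mem_filter.1 hz).2⟩
  have hpoor : (Z.card : ℝ) * (c * s ^ d) ≤ 1 / 4 := by
    calc (Z.card : ℝ) * (c * s ^ d) = c * (Z.card * s ^ d) := by ring
      _ ≤ c * (2 * R + 2 * s) ^ d := by
        gcongr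
        exact card_Icc_floor_mul_pow_le hR hs
      _ ≤ c * (2 * R + 2) ^ d := by gcongr; linarith
      _ = 1 / 4 := by rw [hc]; field_simp
  have hsum : 1 / 2 ≤ T.card * (C * s ^ d) + Z.card * (c * s ^ d) := by
    calc 1 / 2 ≤ ν.real (Metric.closedBall 0 R) := hRν
      _ ≤ ν.real (⋃ z ∈ Z, gridCube s z) :=
        measureReal_mono (closedBall_zero_subset_iUnion_gridCube hs) (measure_ne_top _ _)
      _ ≤ ∑ z ∈ Z, ν.real (gridCube s z) := measureReal_biUnion_finset_le _ _
      _ ≤ T.card * (C * s ^ d) + Z.card * (c * s ^ d) := sum_le_card_filter_le_mul_add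
        (fun z _ => measureReal_gridCube_le hC.le hball hs z) (by positivity)
  rw [div_le_iff₀ (by positivity)]
  linarith

end Cubes

section Occupancy

theorem div_two_mul_pow_le_choose {n m : ℕ} (hm : 2 * m ≤ n) :
    ((n : ℝ) / (2 * m)) ^ m ≤ n.choose m := by
  have hhalf : (n : ℝ) / 2 ≤ ((n + 1 - m : ℕ) : ℝ) := by
    rw [div_le_iff₀ two_pos]
    exact_mod_cast (by lia : n ≤ (n + 1 - m) * 2)
  calc ((n : ℝ) / (2 * m)) ^ m = ((n : ℝ) / 2) ^ m / (m : ℝ) ^ m := by rw [← div_pow, div_div]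
    _ ≤ ((n + 1 - m : ℕ) : ℝ) ^ m / m.factorial := by
        gcongr
        exact_mod_cast Nat.factorial_le_pow m
    _ ≤ n.choose m := Nat.pow_le_choose m n

theorem exp_neg_two_mul_le_one_sub {t : ℝ} (ht₀ : 0 ≤ t) (ht : t ≤ 1 / 2) :
    Real.exp (-(2 * t)) ≤ 1 - t := by
  rw [Real.exp_neg]
  refine inv_le_of_inv_le₀ (by linarith) (le_trans ?_ (Real.add_one_le_exp (2 * t)))
  rw [inv_le_iff_one_le_mul₀ (by linarith)]
  nlinarith

theorem div_pow_mul_exp_le_choose_mul {n m : ℕ} {q t : ℝ} (hq : 0 ≤ q) (ht₀ : 0 ≤ t)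
    (ht : t ≤ 1 / 2) (hm : 2 * m ≤ n) :
    (n * q / (2 * m)) ^ m * Real.exp (-(2 * (n * t))) ≤
      n.choose m * (q ^ m * (1 - t) ^ (n - m)) := by
  have hexp : Real.exp (-(2 * (n * t))) ≤ (1 - t) ^ (n - m) := by
    calc Real.exp (-(2 * (n * t))) = Real.exp (-(2 * t)) ^ n := by
          rw [← Real.exp_nat_mul]
          ring_nf
      _ ≤ (1 - t) ^ n := by
          gcongr
          exact exp_neg_two_mul_le_one_sub ht₀ ht
      _ ≤ (1 - t) ^ (n - m) :=
          pow_le_pow_of_le_one (by linarith) (by linarith) (Nat.sub_le _ _)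
  calc (n * q / (2 * m)) ^ m * Real.exp (-(2 * (n * t)))
      = (n / (2 * m)) ^ m * (q ^ m * Real.exp (-(2 * (n * t)))) := by
        rw [mul_div_right_comm, mul_pow, mul_assoc (_ ^ m)]
    _ ≤ n.choose m * (q ^ m * (1 - t) ^ (n - m)) := by
        gcongr
        exact div_two_mul_pow_le_choose hm

variable {Ω : Type*} [MeasurableSpace Ω] {μ : Measure Ω}

theorem measureReal_forall_pointCount_lt_le_exp {ι κ E : Type*} [MeasurableSpace E]
    {X : ι → Ω → E} {A : κ → Set E} {T : Finset κ} (hind : iIndepFun X μ)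
    (hX : ∀ i, Measurable (X i)) (hA : ∀ j ∈ T, MeasurableSet (A j))
    (hdisj : (T : Set κ).PairwiseDisjoint A) (I : Finset ι) (m : ℕ) {β : ℝ}
    (hβ : ∀ j ∈ T, β ≤ μ.real {ω | m ≤ pointCount (X · ω) I (A j)}) :
    μ.real {ω | ∀ j ∈ T, pointCount (X · ω) I (A j) < m} ≤ Real.exp (-(β * T.card)) := by
  have := hind.isProbabilityMeasure
  have hle : ∀ j ∈ T, μ.real {ω | pointCount (X · ω) I (A j) < m} ≤ Real.exp (-β) := by
    intro j hj
    have hmeas : MeasurableSet {ω | m ≤ pointCount (X · ω) I (A j)} :=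
      measurableSet_le measurable_const (measurable_pointCount fun i _ => hX i (hA j hj))
    have hcompl : {ω | pointCount (X · ω) I (A j) < m} =
        {ω | m ≤ pointCount (X · ω) I (A j)}ᶜ := by
      ext
      simp
    rw [hcompl, probReal_compl_eq_one_sub hmeas]
    linarith [hβ j hj, Real.add_one_le_exp (-β)]
  calc μ.real {ω | ∀ j ∈ T, pointCount (X · ω) I (A j) < m}
      ≤ ∏ j ∈ T, μ.real {ω | pointCount (X · ω) I (A j) < m} :=
        measureReal_forall_pointCount_lt_le_prod hind hX hA hdisj I fun _ => m
    _ ≤ ∏ _j ∈ T, Real.exp (-β) :=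
        Finset.prod_le_prod (fun _ _ => measureReal_nonneg) hle
    _ = Real.exp (-(β * T.card)) := by
        rw [Finset.prod_const, ← Real.exp_nat_mul]
        ring_nf

theorem measureReal_preimage_of_hasLaw {E : Type*} [MeasurableSpace E] {ν : Measure E}
    {Y : Ω → E} (hY : HasLaw Y ν μ) {A : Set E} (hA : MeasurableSet A) :
    μ.real (Y ⁻¹' A) = ν.real A :=
  hY.measureReal_eq (p := (· ∈ A)) hA

variable {d : ℕ} {X : ℕ → Ω → Fin d → ℝ} {ν : Measure (Fin d → ℝ)} {r : ℕ → ℝ} {C : ℝ}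

theorem measureReal_forall_pointCount_gridCube_lt_le (hind : iIndepFun X μ)
    (hX : ∀ i, Measurable (X i)) (hlaw : ∀ i, HasLaw (X i) ν μ) {T : Finset (Fin d → ℤ)}
    {s c c' : ℝ} (hs : 0 < s) (hc : 0 ≤ c) (hC : 0 ≤ C) (hCs : C * s ^ d ≤ 1 / 2)
    (hT : c' ≤ T.card * s ^ d)
    (hν : ∀ z ∈ T, ν.real (gridCube s z) ∈ Set.Icc (c * s ^ d) (C * s ^ d)) {n m : ℕ}
    (hn : 0 < n) (hm : 2 * m ≤ n) :
    μ.real {ω | ∀ z ∈ T, pointCount (X · ω) (Finset.range n) (gridCube s z) < m} ≤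
      Real.exp (-((c / 2 * (n * s ^ d) / m) ^ m * Real.exp (-(2 * C * (n * s ^ d))) *
        (c' * n / (n * s ^ d)))) := by
  have hn' : (0 : ℝ) < n := by exact_mod_cast hn
  have hcount : ∀ z ∈ T,
      (c / 2 * (n * s ^ d) / m) ^ m * Real.exp (-(2 * C * (n * s ^ d))) ≤
        μ.real {ω | m ≤ pointCount (X · ω) (Finset.range n) (gridCube s z)} := by
    intro z hz
    have hchoose := div_pow_mul_exp_le_choose_mul (n := n) (q := c * s ^ d) (t := C * s ^ d)
      (by positivity) (by positivity) hCs hm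
    have hbinom := le_measureReal_le_pointCount (I := Finset.range n) hind hX
      (measurableSet_gridCube s z) (q := c * s ^ d) (t := C * s ^ d) (by positivity) (by linarith)
      (fun i _ => by
        rw [measureReal_preimage_of_hasLaw (hlaw i) (measurableSet_gridCube s z)]
        exact hν z hz) m
    rw [Finset.card_range] at hbinom
    refine Eq.trans_le ?_ (hchoose.trans hbinom)
    ring_nf
  have hcard : c' * n / (n * s ^ d) ≤ T.card := by
    rw [div_le_iff₀ (by positivity)]
    nlinarith
  refine (measureReal_forall_pointCount_lt_le_exp hind hX (fun z _ => measurableSet_gridCube s z)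
    ((pairwise_disjoint_gridCube s).set_pairwise _) _ _ hcount).trans ?_
  gcongr

theorem eventually_measureReal_forall_pointCount_gridCube_lt_le (hind : iIndepFun X μ)
    (hX : ∀ i, Measurable (X i)) (hlaw : ∀ i, HasLaw (X i) ν μ) (hC : 0 < C)
    (hball : ∀ y s, 0 ≤ s → ν.real (Metric.closedBall y s) ≤ C * s ^ d)
    (ha : SubconnectivityRegime fun n => n * r n ^ d) (hr_pos : ∀ᶠ n in atTop, 0 < r n)
    (hr : Tendsto r atTop (𝓝 0)) {κ θ : ℝ} (hκ : 0 < κ) (hθ : θ < 1) :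
    ∀ᶠ n : ℕ in atTop, ∀ m : ℕ, m ≠ 0 → m ≤ θ * clusterSize (fun n => n * r n ^ d) n →
      μ.real {ω | ∀ z, pointCount (X · ω) (Finset.range n) (gridCube (κ * r n) z) < m} ≤
        (n : ℝ) ^ (-2 : ℝ) := by
  have := hind.isProbabilityMeasure
  have : IsProbabilityMeasure ν := (hlaw 0).isProbabilityMeasure_iff.1 this
  obtain ⟨c, hc, c', hc', hcubes⟩ := exists_finset_le_measureReal_gridCube hC hball
  have hκr : Tendsto (fun n => κ * r n) atTop (𝓝 0) := by simpa using hr.const_mul κ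
  filter_upwards [ha.eventually_two_mul_log_le_occupancy (θ := θ) (c := c / 2 * κ ^ d)
      (C := 2 * C * κ ^ d) (c' := c' / κ ^ d) (by positivity) (by positivity) (by positivity) hθ,
    ha.eventually_mul_clusterSize_le_log (2 * θ),
    ha.eventually_le_mul_log (δ := 1 / (2 * (C * κ ^ d))) (by positivity),
    hr_pos, hκr.eventually_le_const one_pos, eventually_gt_atTop 0]
    with n hocc hk halog hrn hs hn m hm hmk
  have hn' : (0 : ℝ) < n := by exact_mod_cast hn
  have hlog := Real.log_le_self hn'.le
  have hscale : n * (κ * r n) ^ d = κ ^ d * (n * r n ^ d) := by rw [mul_pow]; ring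
  have hsmall : C * (κ * r n) ^ d ≤ 1 / 2 := by
    rw [div_mul_eq_mul_div, one_mul, le_div_iff₀ (by positivity)] at halog
    refine le_of_mul_le_mul_left ?_ hn'
    linear_combination C * hscale + halog / 2 + hlog / 2
  obtain ⟨T, hT, hTν⟩ := hcubes (κ * r n) (by positivity) hs
  calc μ.real {ω | ∀ z, pointCount (X · ω) (Finset.range n) (gridCube (κ * r n) z) < m}
      ≤ μ.real {ω | ∀ z ∈ T, pointCount (X · ω) (Finset.range n) (gridCube (κ * r n) z) < m} :=
        measureReal_mono (fun ω hω z _ => hω z) (measure_ne_top _ _)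
    _ ≤ _ := measureReal_forall_pointCount_gridCube_lt_le hind hX hlaw (by positivity) hc.le hC.le
        hsmall hT
        (fun z hz => ⟨hTν z hz, measureReal_gridCube_le hC.le hball (by positivity) z⟩) hn
        (by exact_mod_cast (by linarith : (2 * m : ℝ) ≤ n))
    _ ≤ Real.exp (Real.log n * -2) := by
        refine Real.exp_le_exp.2 (neg_le.1 (Eq.trans_le (by ring) ((hocc m hm hmk).trans_eq ?_)))
        rw [hscale]
        field_simp
    _ = (n : ℝ) ^ (-2 : ℝ) := (Real.rpow_def_of_pos hn' _).symm

end Occupancy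

section Limit

theorem exists_measurable_hasLaw_iIndepFun {ι Ω E : Type*} [Countable ι] [MeasurableSpace Ω]
    [MeasurableSpace E] {μ : Measure Ω} {ν : Measure E} {X : ι → Ω → E}
    (hlaw : ∀ i, HasLaw (X i) ν μ) (hind : iIndepFun X μ) :
    ∃ Y : ι → Ω → E, (∀ i, Measurable (Y i)) ∧ (∀ i, HasLaw (Y i) ν μ) ∧ iIndepFun Y μ ∧
      ∀ᵐ ω ∂μ, ∀ i, X i ω = Y i ω :=
  have hXY i := (hlaw i).aemeasurable.ae_eq_mk
  ⟨fun i => (hlaw i).aemeasurable.mk (X i), fun i => (hlaw i).aemeasurable.measurable_mk,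
    fun i => (hlaw i).congr (hXY i).symm, hind.congr hXY, ae_all_iff.2 hXY⟩

theorem tendsto_natCast_div_of_floor_le_of_le_ceil {α : Type*} {f : Filter α} {k : α → ℝ}
    (hk : Tendsto k f atTop) {u v : ℕ → ℝ} {b : ℝ} (hu : Tendsto u atTop (𝓝 b))
    (hv : Tendsto v atTop (𝓝 b)) (hu₀ : ∀ j, 0 ≤ u j) (hv₀ : ∀ j, 0 ≤ v j) {x : α → ℕ}
    (hlo : ∀ j, ∀ᶠ n in f, ⌊u j * k n⌋₊ ≤ x n) (hhi : ∀ j, ∀ᶠ n in f, x n ≤ ⌈v j * k n⌉₊) :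
    Tendsto (fun n => (x n : ℝ) / k n) f (𝓝 b) := by
  refine tendsto_order.2 ⟨fun c hc => ?_, fun c hc => ?_⟩
  · obtain ⟨j, hj⟩ := (hu.eventually_const_lt hc).exists
    filter_upwards [hlo j, hk.eventually_gt_atTop 0,
      ((tendsto_nat_floor_mul_div_atTop (hu₀ j)).comp hk).eventually_const_lt hj] with n hx hkn hlt
    exact hlt.trans_le (div_le_div_of_nonneg_right (by exact_mod_cast hx) hkn.le)
  · obtain ⟨j, hj⟩ := (hv.eventually_lt_const hc).exists
    filter_upwards [hhi j, hk.eventually_gt_atTop 0,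
      ((tendsto_nat_ceil_mul_div_atTop (hv₀ j)).comp hk).eventually_lt_const hj] with n hx hkn hlt
    exact (div_le_div_of_nonneg_right (by exact_mod_cast hx) hkn.le).trans_lt hlt

theorem ae_tendsto_toNat_div_of_floor_le_of_le_ceil {Ω : Type*} [MeasurableSpace Ω]
    {μ : Measure Ω} {k : ℕ → ℝ} (hk : Tendsto k atTop atTop) {N : ℕ → Ω → ℕ∞}
    (hlo : ∀ θ : ℝ, 0 < θ → θ < 1 → ∀ᵐ ω ∂μ, ∀ᶠ n in atTop, (⌊θ * k n⌋₊ : ℕ∞) ≤ N n ω)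
    (hhi : ∀ θ : ℝ, 1 < θ → ∀ᵐ ω ∂μ, ∀ᶠ n in atTop, N n ω ≤ (⌈θ * k n⌉₊ : ℕ∞)) :
    ∀ᵐ ω ∂μ, Tendsto (fun n => ((N n ω).toNat : ℝ) / k n) atTop (𝓝 1) := by
  obtain ⟨u, -, hu, hu_lim⟩ := exists_seq_strictMono_tendsto' (zero_lt_one (α := ℝ))
  obtain ⟨v, -, hv, hv_lim⟩ := exists_seq_strictAnti_tendsto (1 : ℝ)
  filter_upwards [ae_all_iff.2 fun j => hlo (u j) (hu j).1 (hu j).2,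
    ae_all_iff.2 fun j => hhi (v j) (hv j)] with ω hlow hupp
  refine tendsto_natCast_div_of_floor_le_of_le_ceil hk hu_lim hv_lim (fun j => (hu j).1.le)
    (fun j => (zero_lt_one.trans (hv j)).le) (fun j => ?_) fun j => ?_
  · filter_upwards [hlow j, hupp 0] with n hle hfin
    exact ENat.toNat_le_toNat hle (hfin.trans_lt (ENat.natCast_lt_top _)).ne
  · filter_upwards [hupp j] with n hle
    exact ENat.toNat_le_of_le_natCast hle

end Limit

section ChromaticNumbers

variable {Ω : Type*} [MeasurableSpace Ω] {μ : Measure Ω} {d : ℕ} {X : ℕ → Ω → Fin d → ℝ}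
  {ν : Measure (Fin d → ℝ)} {r : ℕ → ℝ} {C : ℝ}

theorem ae_eventually_floor_le_pointCount_gridCube (hind : iIndepFun X μ)
    (hX : ∀ i, Measurable (X i)) (hlaw : ∀ i, HasLaw (X i) ν μ) (hC : 0 < C)
    (hball : ∀ y s, 0 ≤ s → ν.real (Metric.closedBall y s) ≤ C * s ^ d)
    (ha : SubconnectivityRegime fun n => n * r n ^ d) (hr_pos : ∀ᶠ n in atTop, 0 < r n)
    (hr : Tendsto r atTop (𝓝 0)) {κ θ : ℝ} (hκ : 0 < κ) (hθ₀ : 0 < θ) (hθ : θ < 1) :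
    ∀ᵐ ω ∂μ, ∀ᶠ n : ℕ in atTop, ∃ z, ⌊θ * clusterSize (fun n => n * r n ^ d) n⌋₊ ≤
      pointCount (X · ω) (Finset.range n) (gridCube (κ * r n) z) := by
  have := hind.isProbabilityMeasure
  have hbound : ∀ᶠ n : ℕ in atTop, μ.real {ω | ∀ z,
      pointCount (X · ω) (Finset.range n) (gridCube (κ * r n) z) <
        ⌊θ * clusterSize (fun n => n * r n ^ d) n⌋₊} ≤ (n : ℝ) ^ (-2 : ℝ) := by
    filter_upwards [eventually_measureReal_forall_pointCount_gridCube_lt_le hind hX hlaw hC hball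
      ha hr_pos hr hκ hθ,
      (ha.tendsto_clusterSize_atTop.const_mul_atTop hθ₀).eventually_ge_atTop 1] with n hn hk
    exact hn _ (Nat.floor_pos.2 hk).ne' (Nat.floor_le (zero_le_one.trans hk))
  filter_upwards [ae_eventually_notMem_of_eventually_le
    (Real.summable_nat_rpow.2 (by norm_num : (-2 : ℝ) < -1)) hbound] with ω hω
  filter_upwards [hω] with n hn
  simpa using hn

theorem ae_eventually_pointCount_closedBall_le_ceil (hind : iIndepFun X μ)
    (hX : ∀ i, Measurable (X i)) (hlaw : ∀ i, HasLaw (X i) ν μ) (hC : 0 < C) (hd : d ≠ 0)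
    (hball : ∀ y s, 0 ≤ s → ν.real (Metric.closedBall y s) ≤ C * s ^ d)
    (ha : SubconnectivityRegime fun n => n * r n ^ d) (hr_nonneg : ∀ n, 0 ≤ r n)
    {κ θ : ℝ} (hκ : 0 < κ) (hθ : 1 < θ) :
    ∀ᵐ ω ∂μ, ∀ᶠ n : ℕ in atTop, ∀ v < n,
      pointCount (X · ω) (Finset.range n) (Metric.closedBall (X v ω) (κ * r n)) ≤
        ⌈θ * clusterSize (fun n => n * r n ^ d) n⌉₊ := by
  obtain ⟨η, hη, hηθ⟩ := exists_between hθ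
  have hball' : ∀ i y s, 0 ≤ s → μ.real (X i ⁻¹' Metric.closedBall y s) ≤ C * s ^ d :=
    fun i y s hs => (measureReal_preimage_of_hasLaw (hlaw i)
      Metric.isClosed_closedBall.measurableSet).trans_le (hball y s hs)
  filter_upwards [ae_eventually_pointCount_closedBall_le hind hX hC hd hball' (sub_pos.2 hη)]
    with ω hω
  filter_upwards [hω, ha.eventually_div_pow_le_rpow_neg (C := 2 * Real.exp 1 * C * κ ^ d)
      (by positivity) hθ.le hηθ,
    ha.eventually_mul_clusterSize_le_log (θ + 1),
    ha.tendsto_clusterSize_atTop.eventually_ge_atTop 1, eventually_gt_atTop 0]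
    with n hcount hpow hlog hk hn
  set k := clusterSize (fun n => n * r n ^ d) n
  have hceil : (⌈θ * k⌉₊ : ℝ) ≤ Real.log n :=
    (Nat.ceil_lt_add_one (by positivity)).le.trans (by linarith)
  refine hcount _ (Nat.ceil_pos.2 (by positivity)).ne' hceil _ (mul_nonneg hκ.le (hr_nonneg n)) ?_
  calc n * (2 * Real.exp 1 * C * (n * (κ * r n) ^ d) / ⌈θ * k⌉₊) ^ ⌈θ * k⌉₊
      = n * (2 * Real.exp 1 * C * κ ^ d * (n * r n ^ d) / ⌈θ * k⌉₊) ^ ⌈θ * k⌉₊ := by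
        rw [mul_pow κ]; ring_nf
    _ ≤ n * (n : ℝ) ^ (-η) := by
        gcongr
        exact hpow _ (Nat.le_ceil _)
    _ = (n : ℝ) ^ (-(η - 1)) := by
        rw [mul_comm, ← Real.rpow_add_one (by exact_mod_cast hn.ne')]
        ring_nf

theorem SubconnectivityRegime.dim_ne_zero (ha : SubconnectivityRegime fun n => n * r n ^ d) :
    d ≠ 0 := by
  rintro rfl
  obtain ⟨n, hlog, hn⟩ :=
    ((ha.eventually_le_mul_log one_pos).and (eventually_gt_atTop 0)).exists
  have hlt := Real.log_le_sub_one_of_pos (x := n) (by exact_mod_cast hn)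
  rw [pow_zero, mul_one, one_mul] at hlog
  linarith

theorem SubconnectivityRegime.eventually_radius_pos
    (ha : SubconnectivityRegime fun n => n * r n ^ d) (hr_nonneg : ∀ n, 0 ≤ r n) :
    ∀ᶠ n in atTop, 0 < r n := by
  filter_upwards [ha.eventually_pos] with n hn
  refine (hr_nonneg n).lt_of_ne' fun hr₀ => hn.ne' ?_
  rw [hr₀, zero_pow ha.dim_ne_zero, mul_zero]

theorem ae_tendsto_toNat_div_clusterSize (hind : iIndepFun X μ)
    (hX : ∀ i, Measurable (X i)) (hlaw : ∀ i, HasLaw (X i) ν μ) (hC : 0 < C)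
    (hball : ∀ y s, 0 ≤ s → ν.real (Metric.closedBall y s) ≤ C * s ^ d)
    (ha : SubconnectivityRegime fun n => n * r n ^ d) (hr_nonneg : ∀ n, 0 ≤ r n)
    (hr : Tendsto r atTop (𝓝 0)) {p : ℝ≥0∞} (hp : 1 ≤ p) {l : ℕ} (hl : 1 ≤ l)
    {N : ℕ → Ω → ℕ∞} (hlo : ∀ n ω, (randomGeometricGraph p X r n ω).chromaticNumber ≤ N n ω)
    (hhi : ∀ n ω, N n ω ≤ distantChromaticNumber (randomGeometricGraph p X r n ω) l) :
    ∀ᵐ ω ∂μ, Tendsto (fun n => ((N n ω).toNat : ℝ) / clusterSize (fun n => n * r n ^ d) n)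
      atTop (𝓝 1) := by
  have hr_pos := ha.eventually_radius_pos hr_nonneg
  refine ae_tendsto_toNat_div_of_floor_le_of_le_ceil ha.tendsto_clusterSize_atTop
    (fun θ hθ₀ hθ => ?_) fun θ hθ => ?_
  · filter_upwards [ae_eventually_floor_le_pointCount_gridCube hind hX hlaw hC hball ha hr_pos hr
      (κ := 1 / (d + 1)) (by positivity) hθ₀ hθ] with ω hω
    filter_upwards [hω, hr_pos] with n ⟨z, hz⟩ hrn
    rw [one_div_mul_eq_div, ← pointCount_univ_fin] at hz
    exact (Nat.cast_le.2 hz).trans ((pointCount_gridCube_le_chromaticNumber hp hrn z).trans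
      (hlo n ω))
  · filter_upwards [ae_eventually_pointCount_closedBall_le_ceil hind hX hlaw hC ha.dim_ne_zero
      hball ha hr_nonneg (κ := l) (by exact_mod_cast hl) hθ] with ω hω
    filter_upwards [hω] with n hn
    refine (hhi n ω).trans (distantChromaticNumber_geometricGraph_le hp (hr_nonneg n) fun v => ?_)
    exact (pointCount_univ_fin (X · ω) n).trans_le (hn v v.isLt)

end ChromaticNumbers

theorem theorem4 {Ω : Type*} [MeasurableSpace Ω] (μ : Measure Ω) [IsProbabilityMeasure μ]
    (d : ℕ) (p : ℝ≥0∞) (hp : 1 ≤ p)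
    (f : (Fin d → ℝ) → ℝ) (hf_meas : Measurable f) (hf_nonneg : ∀ x, 0 ≤ f x)
    (hf_bdd : ∃ M : ℝ, ∀ᵐ x, f x ≤ M)
    (X : ℕ → Ω → Fin d → ℝ)
    (hX_law : ∀ i, HasLaw (X i) (volume.withDensity fun x => ENNReal.ofReal (f x)) μ)
    (hX_indep : iIndepFun X μ)
    (r : ℕ → ℝ) (hr_nonneg : ∀ n, 0 ≤ r n) (hr_lim : Tendsto r atTop (𝓝 0))
    (hr_lower : ∀ ε : ℝ, 0 < ε →
      (fun n : ℕ => (n : ℝ) ^ (-ε)) =o[atTop] fun n : ℕ => (n : ℝ) * r n ^ d)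
    (hr_upper : (fun n : ℕ => (n : ℝ) * r n ^ d) =o[atTop] fun n : ℕ => Real.log (n : ℝ))
    (l : ℕ) (hl : 1 ≤ l) :
    ∀ᵐ ω ∂μ, Tendsto
      (fun n : ℕ =>
        ((distantChromaticNumber (randomGeometricGraph p X r n ω) l).toNat : ℝ) /
          ((randomGeometricGraph p X r n ω).chromaticNumber.toNat : ℝ))
      atTop (𝓝 1) := by
  obtain ⟨C, hC, hball⟩ := exists_measureReal_withDensity_closedBall_le hf_bdd
  obtain ⟨Y, hY, hY_law, hY_indep, hXY⟩ := exists_measurable_hasLaw_iIndepFun hX_law hX_indep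
  have ha : SubconnectivityRegime fun n : ℕ => n * r n ^ d :=
    ⟨fun n => mul_nonneg n.cast_nonneg (pow_nonneg (hr_nonneg n) d), hr_lower, hr_upper⟩
  have hle (n ω) :=
    chromaticNumber_le_distantChromaticNumber (G := randomGeometricGraph p Y r n ω) hl
  filter_upwards [hXY,
    ae_tendsto_toNat_div_clusterSize hY_indep hY hY_law hC hball ha hr_nonneg hr_lim hp hl
      (fun _ _ => le_rfl) hle,
    ae_tendsto_toNat_div_clusterSize hY_indep hY hY_law hC hball ha hr_nonneg hr_lim hp hl
      hle fun _ _ => le_rfl] with ω hω hχ hχl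
  have hG (n) : randomGeometricGraph p X r n ω = randomGeometricGraph p Y r n ω := by
    simp only [randomGeometricGraph, hω]
  have hlim := hχl.div hχ one_ne_zero
  rw [div_one] at hlim
  refine hlim.congr' ?_
  filter_upwards [ha.tendsto_clusterSize_atTop.eventually_ne_atTop 0] with n hk
  rw [hG, Pi.div_apply, div_div_div_cancel_right₀ hk]
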